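/- Let $X\subset\mathbb R^d$ be bounded, let $\rho$ be a probability distribution on $X\times\{1,-1\}$ with $p:=\Pr(y=1)\in(0,1)$, and put $\kappa=\max\{1,\sup_{x\in X}\|x\|_2\}$. Consider the unregularized ($\Omega=0$) least-square AUC objective $$\phi(w)=f(w)=p(1-p)\,\mathbb E\big[(1-w^\top(x-x'))^2\,\big|\,y=1,\,y'=-1\big],\qquad w\in\mathbb R^d,$$ where $(x,y),(x',y')$ are drawn independently from $\rho$. Let $S^*$ be the set of minimizers of $\phi$, and let $w^*$ denote the projection of $w$ onto $S^*$. Given examples $z_i=(x_i,y_i)$, $i\ge 0$, drawn independently from $\rho$, put for $t\ge1$ $$p_t=\frac1t\sum_{i<t}\mathbb I_{[y_i=1]},\qquad u_t=\frac{\sum_{i<t}x_i\mathbb I_{[y_i=1]}}{\sum_{i<t}\mathbb I_{[y_i=1]}},\qquad v_t=\frac{\sum_{i<t}x_i\mathbb I_{[y_i=-1]}}{\sum_{i<t}\mathbb I_{[y_i=-1]}}$$ (a mean over no examples is $0$), and let $\hat F_t'(w;z)$ be the gradient in $w$ of $$\hat F_t(w;z)=(1-p_t)(w^\top(x-u_t))^2\mathbb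 I_{[y=1]}+p_t(w^\top(x-v_t))^2\mathbb I_{[y=-1]}+2p_t(1-p_t)w^\top(v_t-u_t)+p_t(1-p_t)(w^\top(v_t-u_t))^2+p_t(1-p_t).$$ The algorithm SPAUC with $\Omega=0$ and step sizes $\eta_t>0$ is $w_1=0$ and $$w_{t+1}=\arg\min_{w\in\mathbb R^d}\ \eta_t\langle w-w_t,\hat F_t'(w_t;z_t)\rangle+\tfrac12\|w-w_t\|_2^2,\qquad t\ge1 .$$ Then the projection $w^*$ exists and is unique for every $w$, and there is $\sigma_\phi>0$ with the quadratic functional growth property $$\phi(w)-\phi(w^*)\ge\sigma_\phi\|w-w^*\|_2^2\qquad\text{for all }w\in\mathbb R^d .$$ Moreover, for every $\sigma_\phi>0$ with this property there are constants $C$ and $m$, depending only on $X$, $\rho$ and $\sigma_\phi$, such that the following holds for all integers $T>2$, all $\delta\in(0,1)$ and all real $t_1\ge 32\cdot16\kappa^2\sigma_\phi^{-1}\log\frac{2T}{\delta}$. If $\{w_t\}$ is produced by SPAUC with $$\eta_t=\frac{2}{\sigma_\phi t+2\sigma_\phi+\sigma_\phi t_1},$$ then with probability at least $1-\delta$, simultaneously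 for all $t=1,\dots,T$, $$\|w_t-w_t^*\|_2^2\le\frac{C(1+t_1)\log^m(T/\delta)}{t}\qquad\text{and}\qquad \phi(\bar w_t^{(2)})-\inf_w\phi(w)\le\frac{C(1+t_1)\log^m(T/\delta)}{t},$$ where $\bar w_t^{(2)}=\big(\sum_{k=1}^t(k+t_1+1)\big)^{-1}\sum_{k=1}^t(k+t_1+1)w_k$. In particular, if $t_1$ is of the order of $\log\frac{2T}{\delta}$, both quantities are $\widetilde O(1/t)$, where $\widetilde O$ hides polynomials of $\log(T/\delta)$. -/

import Mathlib

open MeasureTheory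

noncomputable section

namespace SPAUC

/-- The Euclidean space `ℝ^d`. -/
abbrev E (d : ℕ) : Type := EuclideanSpace ℝ (Fin d)

/-- A labelled example `(x, y)`; the label `y` takes the values `1` and `-1`. -/
abbrev Example (d : ℕ) : Type := E d × ℝ

variable {d : ℕ}

/-! ### The objective function -/

/-- `p = Pr(y = 1)`. -/
def posProb (ρ : Measure (Example d)) : ℝ := ρ.real {z | z.2 = 1}

/-- The least-square AUC risk
`f(w) = p (1 - p) E[(1 - wᵀ(x - x'))² | y = 1, y' = -1]`,
with `(x, y)` and `(x', y')` drawn independently from `ρ`. -/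
def risk (ρ : Measure (Example d)) (w : E d) : ℝ :=
  posProb ρ * (1 - posProb ρ) *
    ∫ q, (1 - inner ℝ w (q.1.1 - q.2.1)) ^ 2
      ∂(ProbabilityTheory.cond (ρ.prod ρ) {q | q.1.2 = 1 ∧ q.2.2 = -1})

/-- The regularized objective `φ = f + Ω`. -/
def phi (ρ : Measure (Example d)) (Reg : E d → ℝ) (w : E d) : ℝ := risk ρ w + Reg w

/-- The set `S*` of minimizers of `φ`. -/
def solSet (φ : E d → ℝ) : Set (E d) := {w | ∀ v, φ w ≤ φ v}

/-- `v` is a projection of `w` onto `S`: a point of `S` nearest to `w`. -/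
def IsProj (S : Set (E d)) (w v : E d) : Prop := v ∈ S ∧ ∀ u ∈ S, ‖w - v‖ ≤ ‖w - u‖

/-- Quadratic functional growth with parameter `σ > 0`:
`φ(w) - φ(w*) ≥ σ ‖w - w*‖²`, where `w*` is the projection of `w` onto the minimizers of `φ`. -/
def QuadraticGrowth (φ : E d → ℝ) (σ : ℝ) : Prop :=
  0 < σ ∧ ∀ w v, IsProj (solSet φ) w v → σ * ‖w - v‖ ^ 2 ≤ φ w - φ v

/-- `κ = max {1, sup_{x ∈ X} ‖x‖}`. -/
def kappa (X : Set (E d)) : ℝ := max 1 (⨆ x : X, ‖(x : E d)‖)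

/-! ### The algorithm -/

/-- `1` if the label is `c`, and `0` otherwise. -/
def ind (c : ℝ) (z : Example d) : ℝ := if z.2 = c then 1 else 0

/-- `p_t`, the fraction of positive examples among `z_0, …, z_{t-1}`. -/
def pHat (z : ℕ → Example d) (t : ℕ) : ℝ := (∑ i ∈ Finset.range t, ind 1 (z i)) / t

/-- The mean of the inputs with label `c` among `z_0, …, z_{t-1}` (`0` if there are none);
`u_t = meanHat 1 z t` and `v_t = meanHat (-1) z t`. -/
def meanHat (c : ℝ) (z : ℕ → Example d) (t : ℕ) : E d :=
  (∑ i ∈ Finset.range t, ind c (z i))⁻¹ • ∑ i ∈ Finset.range t, ind c (z i) • (z i).1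

/-- The function `F(w; (x, y))` with parameters `p`, `u`, `v`. -/
def lossHat (p : ℝ) (u v : E d) (w : E d) (z : Example d) : ℝ :=
  (1 - p) * (inner ℝ w (z.1 - u)) ^ 2 * ind 1 z + p * (inner ℝ w (z.1 - v)) ^ 2 * ind (-1) z
    + 2 * p * (1 - p) * inner ℝ w (v - u) + p * (1 - p) * (inner ℝ w (v - u)) ^ 2 + p * (1 - p)

/-- The gradient of `lossHat` with respect to `w`. -/
def gradHat (p : ℝ) (u v : E d) (w : E d) (z : Example d) : E d :=
  (2 * (1 - p) * ind 1 z * inner ℝ w (z.1 - u)) • (z.1 - u)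
    + (2 * p * ind (-1) z * inner ℝ w (z.1 - v)) • (z.1 - v)
    + (2 * p * (1 - p)) • (v - u)
    + (2 * p * (1 - p) * inner ℝ w (v - u)) • (v - u)

theorem hasGradientAt_lossHat (p : ℝ) (u v w : E d) (z : Example d) :
    HasGradientAt (fun w => lossHat p u v w z) (gradHat p u v w z) w := by
  have h (a : E d) : HasFDerivAt (fun w : E d => inner ℝ w a) (innerSL ℝ a) w := by
    have := (innerSL ℝ a).hasFDerivAt (x := w)
    refine this.congr_of_eventuallyEq (Filter.Eventually.of_forall fun w => ?_)
    simp [real_inner_comm]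
  rw [hasGradientAt_iff_hasFDerivAt]
  unfold lossHat
  refine (((((((h (z.1 - u)).pow 2).const_mul (1 - p)).mul_const (ind 1 z)).add
    ((((h (z.1 - v)).pow 2).const_mul p).mul_const (ind (-1) z))).add
    ((h (v - u)).const_mul (2 * p * (1 - p)))).add
    (((h (v - u)).pow 2).const_mul (p * (1 - p)))).add_const (p * (1 - p)) |>.congr_fderiv ?_
  ext x
  simp [gradHat]
  ring

/-- `w` is the sequence produced from the examples `z_0, z_1, …` by stochastic proximal AUC
maximization with regularizer `Reg` and step sizes `η`: `w_1 = 0`, and for every `t ≥ 1`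
`w_{t+1}` minimizes
`η_t ⟨w - w_t, F̂'_t(w_t; z_t)⟩ + η_t Ω(w) + ‖w - w_t‖² / 2` over all `w`. -/
def IsSPAUC (Reg : E d → ℝ) (η : ℕ → ℝ) (z : ℕ → Example d) (w : ℕ → E d) : Prop :=
  w 1 = 0 ∧ ∀ t : ℕ, 1 ≤ t →
    IsMinOn (fun v : E d =>
      η t * inner ℝ (v - w t)
          (gradHat (pHat z t) (meanHat 1 z t) (meanHat (-1) z t) (w t) (z t))
        + η t * Reg v + 1 / 2 * ‖v - w t‖ ^ 2) Set.univ (w (t + 1))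

/-- The step sizes `η_t = 2 / (σ_φ t + 2 σ_f + σ_φ t₁)`. -/
def stepSize (σφ σf t₁ : ℝ) (t : ℕ) : ℝ := 2 / (σφ * t + 2 * σf + σφ * t₁)

/-- The weighted average
`(∑_{k=1}^t (k + t₁ + 1))⁻¹ ∑_{k=1}^t (k + t₁ + 1) w_k`. -/
def wAvg (t₁ : ℝ) (w : ℕ → E d) (t : ℕ) : E d :=
  (∑ k ∈ Finset.Icc 1 t, ((k : ℝ) + t₁ + 1))⁻¹ •
    ∑ k ∈ Finset.Icc 1 t, ((k : ℝ) + t₁ + 1) • w k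

end SPAUC

end

open MeasureTheory

noncomputable section

namespace SPAUC

variable {d : ℕ}

/-! ### Deterministic facts about the algorithm -/

/-! Without a regularizer the method is the explicit recursion `w (t+1) = w t - η t • ĝ t`. The
proof has four ingredients.

Structure of the risk. Expanding the square over a pair splits the risk into two within-class
variances and a term in the difference of the class means. It is therefore the expectation of a loss
of one example with parameters `p` and the two class means (`risk_eq_integral_lossPop`), so
`gradPop` is an unbiased gradient. The risk is moreover a nonnegative quadratic with positive
semidefinite symmetric form `hess`. Hence its minimizers form an affine subspace parallel to `ker
(hess h)`, projections are orthogonal, and the form is coercive on the orthogonal complement, which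
gives quadratic growth.

Size of the iterates. The empirical loss is a sum of weighted squares, so the squared norm of its
gradient is at most a multiple of the loss. This lets a small step increase `‖w‖ ^ 2` by at most `2
* η`, so `‖w t‖ ^ 2` is of order `log t` on every path with bounded inputs (`norm_spaucSeq_sq_le`).

Recursion. Multiply the one-step inequality for the squared distance to the minimizers by `(a + 1) *
a` with `a = k + t₁ + 1`. The distances telescope, and a negative multiple of the weighted excess
risks `a * Δ` is left over (`weighted_step_le`). The gradient error consists of a bias, from using
empirical instead of true parameters, and of `noise`, a martingale difference. The squared bias is
of order `1 / k` up to logarithms, hence summable against the weights at the cost of one logarithm.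

Noise. Its conditional size is controlled by the distance to the minimizers, so growth bounds its
quadratic variation by the excess risks themselves. An exponential inequality with predictable
variation, at a tilt chosen separately for each `t`, absorbs that variation into half of the
negative term (`sum_noise_le`).

A union bound over `t ≤ T` and finitely many statistics provides the event (`measure_good_ge`). On
it `pathwise_bound` bounds distance and weighted excess risk together, and convexity passes to the
averaged iterate. -/

theorem eq_sub_smul_of_isMinOn {η : ℝ} {w g w' : E d}
    (h : IsMinOn (fun v : E d => η * inner ℝ (v - w) g + η * 0 + 1 / 2 * ‖v - w‖ ^ 2)
      Set.univ w') : w' = w - η • g := by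
  -- Completing the square: the unique minimizer is the point where the square vanishes.
  have key : ∀ v : E d, η * inner ℝ (v - w) g + η * 0 + 1 / 2 * ‖v - w‖ ^ 2
      = 1 / 2 * ‖v - w + η • g‖ ^ 2 - 1 / 2 * (η ^ 2 * ‖g‖ ^ 2) := by
    intro v
    rw [norm_add_sq_real, norm_smul, inner_smul_right, Real.norm_eq_abs, mul_pow, sq_abs]
    ring
  have h1 := h (Set.mem_univ (w - η • g))
  simp only [Set.mem_ofPred_eq] at h1
  rw [key, key] at h1
  have h2 : w - η • g - w + η • g = 0 := by abel
  rw [h2, norm_zero] at h1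
  have h3 : ‖w' - w + η • g‖ = 0 := by
    have := sq_nonneg ‖w' - w + η • g‖
    exact pow_eq_zero_iff (two_ne_zero) |>.1 (by linarith)
  rw [norm_eq_zero] at h3
  rw [eq_sub_iff_add_eq, ← sub_eq_zero, ← h3]
  abel

/-- The stochastic gradient at time `t`. -/
def stochGrad (z : ℕ → Example d) (w : E d) (t : ℕ) : E d :=
  gradHat (pHat z t) (meanHat 1 z t) (meanHat (-1) z t) w (z t)

/-- The iterates of the unregularized algorithm as a function of the examples. -/
def spaucSeq (η : ℕ → ℝ) (z : ℕ → Example d) : ℕ → E d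
  | 0 => 0
  | t + 1 => spaucSeq η z t - η t • stochGrad z (spaucSeq η z t) t

/-- The recursion starts at index `0`, where `pHat` is `0 / 0 = 0` and the iterate is zero, so every
term of the gradient vanishes and the step does not move. -/
theorem spaucSeq_one (η : ℕ → ℝ) (z : ℕ → Example d) : spaucSeq η z 1 = 0 := by
  simp [spaucSeq, stochGrad, gradHat, pHat]

theorem IsSPAUC.eq_spaucSeq {η : ℕ → ℝ} {z : ℕ → Example d} {w : ℕ → E d}
    (h : IsSPAUC (fun _ => 0) η z w) : ∀ t, 1 ≤ t → w t = spaucSeq η z t := by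
  intro t ht
  induction t, ht using Nat.le_induction with
  | base => rw [h.1, spaucSeq_one]
  | succ t ht ih => rw [eq_sub_smul_of_isMinOn (h.2 t ht), spaucSeq, ← ih, stochGrad]

/-! ### Empirical frequencies, moments and class means -/

theorem ind_nonneg (c : ℝ) (z : Example d) : 0 ≤ ind c z := by unfold ind; split_ifs <;> norm_num

theorem ind_le_one (c : ℝ) (z : Example d) : ind c z ≤ 1 := by unfold ind; split_ifs <;> norm_num

theorem abs_ind_le_one (c : ℝ) (z : Example d) : |ind c z| ≤ 1 :=
  abs_le.2 ⟨by linarith [ind_nonneg c z], ind_le_one c z⟩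

/-- The empirical frequency of the label `c`. -/
def freqHat (c : ℝ) (z : ℕ → Example d) (t : ℕ) : ℝ := (∑ i ∈ Finset.range t, ind c (z i)) / t

/-- The empirical average of `x 𝟙[y = c]`. -/
def momHat (c : ℝ) (z : ℕ → Example d) (t : ℕ) : E d :=
  (t : ℝ)⁻¹ • ∑ i ∈ Finset.range t, ind c (z i) • (z i).1

theorem freqHat_nonneg (c : ℝ) (z : ℕ → Example d) (t : ℕ) : 0 ≤ freqHat c z t :=
  div_nonneg (Finset.sum_nonneg fun _ _ => ind_nonneg _ _) (Nat.cast_nonneg _)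

theorem freqHat_le_one (c : ℝ) (z : ℕ → Example d) (t : ℕ) : freqHat c z t ≤ 1 := by
  refine div_le_one_of_le₀ ?_ (Nat.cast_nonneg _)
  calc ∑ i ∈ Finset.range t, ind c (z i) ≤ ∑ i ∈ Finset.range t, (1 : ℝ) :=
        Finset.sum_le_sum fun _ _ => ind_le_one _ _
    _ = t := by simp

theorem pHat_nonneg (z : ℕ → Example d) (t : ℕ) : 0 ≤ pHat z t := freqHat_nonneg 1 z t

theorem pHat_le_one (z : ℕ → Example d) (t : ℕ) : pHat z t ≤ 1 := freqHat_le_one 1 z t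

theorem norm_sum_ind_smul_le {c κ : ℝ} {z : ℕ → Example d} (hz : ∀ i, ‖(z i).1‖ ≤ κ) (t : ℕ) :
    ‖∑ i ∈ Finset.range t, ind c (z i) • (z i).1‖ ≤ (∑ i ∈ Finset.range t, ind c (z i)) * κ := by
  rw [Finset.sum_mul]
  refine norm_sum_le_of_le _ fun i _ => ?_
  rw [norm_smul, Real.norm_eq_abs, abs_of_nonneg (ind_nonneg _ _)]
  exact mul_le_mul_of_nonneg_left (hz i) (ind_nonneg _ _)

theorem norm_meanHat_le {c κ : ℝ} (hκ : 0 ≤ κ) {z : ℕ → Example d} (hz : ∀ i, ‖(z i).1‖ ≤ κ)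
    (t : ℕ) : ‖meanHat c z t‖ ≤ κ := by
  have h0 : 0 ≤ ∑ i ∈ Finset.range t, ind c (z i) := Finset.sum_nonneg fun _ _ => ind_nonneg _ _
  rw [meanHat, norm_smul, norm_inv, Real.norm_eq_abs, abs_of_nonneg h0]
  refine (mul_le_mul_of_nonneg_left (norm_sum_ind_smul_le hz t) (inv_nonneg.2 h0)).trans ?_
  rcases h0.eq_or_lt with h | h
  · rw [← h]; simpa using hκ
  · rw [inv_mul_cancel_left₀ h.ne']

/-- Clears the random denominator of the class mean: both remaining quantities are averages of
independent bounded terms. With no example of the class, both sides are zero. -/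
theorem freqHat_smul_meanHat (c : ℝ) (z : ℕ → Example d) (t : ℕ) :
    freqHat c z t • meanHat c z t = momHat c z t := by
  unfold freqHat meanHat momHat
  have h0 : 0 ≤ ∑ i ∈ Finset.range t, ind c (z i) := Finset.sum_nonneg fun _ _ => ind_nonneg _ _
  rcases h0.eq_or_lt with h | h
  · have : ∑ i ∈ Finset.range t, ind c (z i) • (z i).1 = 0 := by
      refine Finset.sum_eq_zero fun i hi => ?_
      rw [(Finset.sum_eq_zero_iff_of_nonneg fun _ _ => ind_nonneg _ _).1 h.symm i hi, zero_smul]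
    rw [this]; simp
  · rw [smul_smul, div_mul_eq_mul_div, mul_inv_cancel₀ h.ne', one_div]

/-- Empirical class means are close to a vector `u` with `r u = m` as soon as the empirical
frequency and the empirical moment are close to `r` and `m`. -/
theorem norm_meanHat_sub_le {c κ r : ℝ} {u m : E d} (hκ : 0 ≤ κ) {z : ℕ → Example d}
    (hz : ∀ i, ‖(z i).1‖ ≤ κ) (hr : 0 < r)
    (hm : r • u = m) (t : ℕ) :
    ‖meanHat c z t - u‖ ≤ r⁻¹ * (κ * |freqHat c z t - r| + ‖momHat c z t - m‖) := by
  have h1 : r • (meanHat c z t - u) = (r - freqHat c z t) • (meanHat c z t)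
      + (momHat c z t - m) := by
    rw [← freqHat_smul_meanHat, ← hm]
    module
  have h2 : r * ‖meanHat c z t - u‖ ≤ κ * |freqHat c z t - r| + ‖momHat c z t - m‖ := by
    rw [← abs_of_pos hr, ← Real.norm_eq_abs, ← norm_smul, Real.norm_eq_abs, abs_of_pos hr, h1]
    refine (norm_add_le _ _).trans (add_le_add ?_ le_rfl)
    rw [norm_smul, Real.norm_eq_abs, abs_sub_comm]
    nlinarith [norm_meanHat_le (c := c) hκ hz t, abs_nonneg (freqHat c z t - r),
      mul_nonneg hκ (abs_nonneg (freqHat c z t - r))]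
  rw [inv_mul_eq_div, le_div_iff₀ hr]
  linarith

/-! ### Size of the gradient and its dependence on the parameters -/

theorem norm_sub_le_two {κ : ℝ} {x u : E d} (hx : ‖x‖ ≤ κ) (hu : ‖u‖ ≤ κ) : ‖x - u‖ ≤ 2 * κ :=
  (norm_sub_le _ _).trans (by linarith)

/-- Exhibits the gradient of a sum of three weighted squares, the last being `p * (1 - p) * (1 +
inner ℝ w (v - u)) ^ 2`. -/
theorem gradHat_eq (p : ℝ) (u v w : E d) (z : Example d) :
    gradHat p u v w z = (2 * ((1 - p) * ind 1 z) * inner ℝ w (z.1 - u)) • (z.1 - u)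
      + (2 * (p * ind (-1) z) * inner ℝ w (z.1 - v)) • (z.1 - v)
      + (2 * (p * (1 - p)) * (1 + inner ℝ w (v - u))) • (v - u) := by
  unfold gradHat
  module

theorem norm_smul_inner_le {κ c K : ℝ} {x w : E d} (hx : ‖x‖ ≤ 2 * κ) (hc : |c| ≤ K) :
    ‖(c * inner ℝ w x) • x‖ ≤ K * (4 * κ ^ 2 * ‖w‖) := by
  rw [norm_smul, Real.norm_eq_abs, abs_mul, mul_assoc]
  have h1 : |inner ℝ w x| ≤ ‖w‖ * ‖x‖ := abs_real_inner_le_norm _ _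
  have h2 : ‖x‖ * ‖x‖ ≤ (2 * κ) * (2 * κ) :=
    mul_le_mul hx hx (norm_nonneg _) ((norm_nonneg _).trans hx)
  have h3 : |inner ℝ w x| * ‖x‖ ≤ 4 * κ ^ 2 * ‖w‖ :=
    calc |inner ℝ w x| * ‖x‖ ≤ ‖w‖ * ‖x‖ * ‖x‖ := mul_le_mul_of_nonneg_right h1 (norm_nonneg _)
      _ = ‖w‖ * (‖x‖ * ‖x‖) := by ring
      _ ≤ ‖w‖ * ((2 * κ) * (2 * κ)) := mul_le_mul_of_nonneg_left h2 (norm_nonneg _)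
      _ = _ := by ring
  exact mul_le_mul hc h3 (by positivity) ((abs_nonneg _).trans hc)

theorem norm_gradHat_le {κ p : ℝ} {u v w : E d} {z : Example d} (hκ : 1 ≤ κ) (hp0 : 0 ≤ p)
    (hp1 : p ≤ 1) (hu : ‖u‖ ≤ κ) (hv : ‖v‖ ≤ κ) (hz : ‖z.1‖ ≤ κ) :
    ‖gradHat p u v w z‖ ≤ 24 * κ ^ 2 * (1 + ‖w‖) := by
  have i1 := ind_nonneg 1 z
  have i2 := ind_nonneg (-1) z
  have j1 := ind_le_one 1 z
  have j2 := ind_le_one (-1) z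
  have a1 : |2 * (1 - p) * ind 1 z| ≤ 2 := by
    rw [abs_of_nonneg (mul_nonneg (by linarith) i1)]; nlinarith
  have a2 : |2 * p * ind (-1) z| ≤ 2 := by
    rw [abs_of_nonneg (mul_nonneg (by linarith) i2)]; nlinarith
  have a3 : |2 * p * (1 - p)| ≤ 2 := by
    rw [abs_of_nonneg (mul_nonneg (by linarith) (by linarith))]; nlinarith
  have h1 := norm_smul_inner_le (w := w) (norm_sub_le_two hz hu) a1
  have h2 := norm_smul_inner_le (w := w) (norm_sub_le_two hz hv) a2
  have h4 := norm_smul_inner_le (w := w) (norm_sub_le_two hv hu) a3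
  have h3 : ‖(2 * p * (1 - p)) • (v - u)‖ ≤ 2 * (2 * κ) := by
    rw [norm_smul]
    exact mul_le_mul a3 (norm_sub_le_two hv hu) (norm_nonneg _) zero_le_two
  unfold gradHat
  refine (norm_add_le _ _).trans ?_
  refine (add_le_add ((norm_add_le _ _).trans (add_le_add (norm_add_le _ _) le_rfl)) le_rfl).trans ?_
  nlinarith [norm_nonneg w]

theorem norm_smul_inner_sub_le {κ c c' K : ℝ} {x x' w : E d} (hx : ‖x‖ ≤ 2 * κ)
    (hx' : ‖x'‖ ≤ 2 * κ) (hc : |c| ≤ K) :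
    ‖(c * inner ℝ w x) • x - (c' * inner ℝ w x') • x'‖
      ≤ |c - c'| * (4 * κ ^ 2 * ‖w‖) + K * (4 * κ * ‖w‖ * ‖x - x'‖) := by
  have e : (c * inner ℝ w x) • x - (c' * inner ℝ w x') • x'
      = c • (inner ℝ w x • (x - x') + inner ℝ w (x - x') • x')
        + ((c - c') * inner ℝ w x') • x' := by
    rw [inner_sub_right]; module
  rw [e]
  have h1 := norm_smul_inner_le (w := w) (c := c - c') hx' le_rfl
  have h2 : ‖inner ℝ w x • (x - x') + inner ℝ w (x - x') • x'‖ ≤ 4 * κ * ‖w‖ * ‖x - x'‖ := by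
    refine (norm_add_le _ _).trans ?_
    rw [norm_smul, norm_smul, Real.norm_eq_abs, Real.norm_eq_abs]
    have b1 : |inner ℝ w x| ≤ ‖w‖ * (2 * κ) :=
      (abs_real_inner_le_norm _ _).trans (mul_le_mul_of_nonneg_left hx (norm_nonneg _))
    have b2 : |inner ℝ w (x - x')| ≤ ‖w‖ * ‖x - x'‖ := abs_real_inner_le_norm _ _
    have b3 := mul_le_mul_of_nonneg_right b1 (norm_nonneg (x - x'))
    have b4 := mul_le_mul b2 hx' (norm_nonneg x') (by positivity)
    linarith
  refine (norm_add_le _ _).trans ?_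
  rw [norm_smul, Real.norm_eq_abs]
  have := mul_le_mul hc h2 (norm_nonneg _) ((abs_nonneg _).trans hc)
  linarith

/-- The gradient is Lipschitz in the estimated parameters. -/
theorem norm_gradHat_sub_le {κ p p' : ℝ} {u u' v v' w : E d} {z : Example d} (hκ : 1 ≤ κ)
    (hp0 : 0 ≤ p) (hp1 : p ≤ 1) (hp0' : 0 ≤ p') (hp1' : p' ≤ 1) (hu : ‖u‖ ≤ κ) (hv : ‖v‖ ≤ κ)
    (hu' : ‖u'‖ ≤ κ) (hv' : ‖v'‖ ≤ κ) (hz : ‖z.1‖ ≤ κ) :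
    ‖gradHat p u v w z - gradHat p' u' v' w z‖
      ≤ 32 * κ ^ 2 * (1 + ‖w‖) * (|p - p'| + ‖u - u'‖ + ‖v - v'‖) := by
  have i1 := ind_nonneg 1 z
  have i2 := ind_nonneg (-1) z
  have j1 := ind_le_one 1 z
  have j2 := ind_le_one (-1) z
  have a1 : |2 * (1 - p) * ind 1 z| ≤ 2 := by
    rw [abs_of_nonneg (mul_nonneg (by linarith) i1)]; nlinarith
  have a2 : |2 * p * ind (-1) z| ≤ 2 := by
    rw [abs_of_nonneg (mul_nonneg (by linarith) i2)]; nlinarith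
  have a3 : |2 * p * (1 - p)| ≤ 2 := by
    rw [abs_of_nonneg (mul_nonneg (by linarith) (by linarith))]; nlinarith
  have c1 : |2 * (1 - p) * ind 1 z - 2 * (1 - p') * ind 1 z| ≤ 2 * |p - p'| := by
    rw [show 2 * (1 - p) * ind 1 z - 2 * (1 - p') * ind 1 z = -(2 * ind 1 z) * (p - p') by ring,
      abs_mul, abs_neg, abs_mul, abs_two]
    nlinarith [abs_ind_le_one 1 z, abs_nonneg (p - p')]
  have c2 : |2 * p * ind (-1) z - 2 * p' * ind (-1) z| ≤ 2 * |p - p'| := by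
    rw [show 2 * p * ind (-1) z - 2 * p' * ind (-1) z = (2 * ind (-1) z) * (p - p') by ring,
      abs_mul, abs_mul, abs_two]
    nlinarith [abs_ind_le_one (-1) z, abs_nonneg (p - p')]
  have c3 : |2 * p * (1 - p) - 2 * p' * (1 - p')| ≤ 2 * |p - p'| := by
    rw [show 2 * p * (1 - p) - 2 * p' * (1 - p') = (2 * (1 - p - p')) * (p - p') by ring,
      abs_mul, abs_mul, abs_two]
    have : |1 - p - p'| ≤ 1 := abs_le.2 ⟨by linarith, by linarith⟩
    nlinarith [abs_nonneg (p - p')]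
  have zu := norm_sub_le_two hz hu
  have zu' := norm_sub_le_two hz hu'
  have zv := norm_sub_le_two hz hv
  have zv' := norm_sub_le_two hz hv'
  have vu := norm_sub_le_two hv hu
  have vu' := norm_sub_le_two hv' hu'
  have d1 : ‖z.1 - u - (z.1 - u')‖ = ‖u - u'‖ := by rw [sub_sub_sub_cancel_left, norm_sub_rev]
  have d2 : ‖z.1 - v - (z.1 - v')‖ = ‖v - v'‖ := by rw [sub_sub_sub_cancel_left, norm_sub_rev]
  have d3 : ‖v - u - (v' - u')‖ ≤ ‖v - v'‖ + ‖u - u'‖ := by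
    rw [sub_sub_sub_comm]; exact norm_sub_le _ _
  have h1 := norm_smul_inner_sub_le (w := w) (c' := 2 * (1 - p') * ind 1 z) zu zu' a1
  have h2 := norm_smul_inner_sub_le (w := w) (c' := 2 * p' * ind (-1) z) zv zv' a2
  have h4 := norm_smul_inner_sub_le (w := w) (c' := 2 * p' * (1 - p')) vu vu' a3
  have h3 : ‖(2 * p * (1 - p)) • (v - u) - (2 * p' * (1 - p')) • (v' - u')‖
      ≤ 2 * |p - p'| * (2 * κ) + 2 * (‖v - v'‖ + ‖u - u'‖) := by
    rw [show (2 * p * (1 - p)) • (v - u) - (2 * p' * (1 - p')) • (v' - u')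
      = (2 * p * (1 - p) - 2 * p' * (1 - p')) • (v' - u')
        + (2 * p * (1 - p)) • (v - u - (v' - u')) by module]
    refine (norm_add_le _ _).trans ?_
    rw [norm_smul, norm_smul]
    exact add_le_add (mul_le_mul c3 vu' (norm_nonneg _) (by positivity))
      (mul_le_mul a3 d3 (norm_nonneg _) zero_le_two)
  rw [d1] at h1
  rw [d2] at h2
  unfold gradHat
  rw [add_sub_add_comm, add_sub_add_comm, add_sub_add_comm]
  refine (norm_add_le _ _).trans ?_
  refine (add_le_add ((norm_add_le _ _).trans (add_le_add (norm_add_le _ _) le_rfl)) le_rfl).trans ?_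
  have hw := norm_nonneg w
  set P := |p - p'|
  set U := ‖u - u'‖
  set V := ‖v - v'‖
  set W := ‖w‖
  have hP : 0 ≤ P := abs_nonneg _
  have hU : 0 ≤ U := norm_nonneg _
  have hV : 0 ≤ V := norm_nonneg _
  have k2 : κ ≤ κ ^ 2 := by nlinarith
  have k1 : 1 ≤ κ ^ 2 := hκ.trans k2
  have e1 := mul_le_mul_of_nonneg_right c1 (show 0 ≤ 4 * κ ^ 2 * W by positivity)
  have e2 := mul_le_mul_of_nonneg_right c2 (show 0 ≤ 4 * κ ^ 2 * W by positivity)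
  have e4 := mul_le_mul_of_nonneg_right c3 (show 0 ≤ 4 * κ ^ 2 * W by positivity)
  have f4 := mul_le_mul_of_nonneg_left d3 (show 0 ≤ 2 * (4 * κ * W) by positivity)
  have g1 : κ * W * U ≤ κ ^ 2 * W * U := by gcongr
  have g2 : κ * W * V ≤ κ ^ 2 * W * V := by gcongr
  have g3 : κ * P ≤ κ ^ 2 * P := by gcongr
  have g4 : U ≤ κ ^ 2 * U := le_mul_of_one_le_left hU k1
  have g5 : V ≤ κ ^ 2 * V := le_mul_of_one_le_left hV k1
  have n1 : 0 ≤ κ ^ 2 * W * U := by positivity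
  have n2 : 0 ≤ κ ^ 2 * W * V := by positivity
  have n3 : 0 ≤ κ ^ 2 * P * W := by positivity
  have n4 : 0 ≤ κ ^ 2 * P := by positivity
  linarith

/-! ### Logarithmic growth of the iterates -/

theorem norm_add_three_sq_le (a b c : E d) :
    ‖a + b + c‖ ^ 2 ≤ 3 * (‖a‖ ^ 2 + ‖b‖ ^ 2 + ‖c‖ ^ 2) := by
  have h := (norm_add_le (a + b) c).trans (add_le_add (norm_add_le a b) le_rfl)
  have h2 := pow_le_pow_left₀ (norm_nonneg _) h 2
  nlinarith [sq_nonneg (‖a‖ - ‖b‖), sq_nonneg (‖a‖ - ‖c‖), sq_nonneg (‖b‖ - ‖c‖)]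

/-- Since `c ^ 2 ≤ c`, the squared gradient of the weighted square `c * s ^ 2` is bounded by that
same quantity: the self-bounding property of a smooth nonnegative loss. -/
theorem norm_smul_sq_le {κ c s : ℝ} {x : E d} (hx : ‖x‖ ≤ 2 * κ) (hc0 : 0 ≤ c) (hc1 : c ≤ 1) :
    ‖(2 * c * s) • x‖ ^ 2 ≤ 16 * κ ^ 2 * (c * s ^ 2) := by
  rw [norm_smul, mul_pow, Real.norm_eq_abs, sq_abs]
  have h1 : ‖x‖ ^ 2 ≤ 4 * κ ^ 2 := by
    have := pow_le_pow_left₀ (norm_nonneg _) hx 2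
    linarith
  have h2 : c ^ 2 ≤ c := by nlinarith
  calc (2 * c * s) ^ 2 * ‖x‖ ^ 2 ≤ (2 * c * s) ^ 2 * (4 * κ ^ 2) := by gcongr
    _ = 16 * κ ^ 2 * s ^ 2 * c ^ 2 := by ring
    _ ≤ 16 * κ ^ 2 * s ^ 2 * c := by gcongr
    _ = _ := by ring

/-- One gradient step with a small step size increases the squared norm by at most `2η`. -/
theorem norm_gradient_step_sq_le {κ p η : ℝ} {u v w : E d} {z : Example d} (hp0 : 0 ≤ p)
    (hp1 : p ≤ 1) (hu : ‖u‖ ≤ κ) (hv : ‖v‖ ≤ κ) (hz : ‖z.1‖ ≤ κ) (hη : 0 ≤ η)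
    (hηκ : 24 * κ ^ 2 * η ≤ 1) :
    ‖w - η • gradHat p u v w z‖ ^ 2 ≤ ‖w‖ ^ 2 + 2 * η := by
  have i1 := ind_nonneg 1 z
  have i2 := ind_nonneg (-1) z
  have j1 := ind_le_one 1 z
  have j2 := ind_le_one (-1) z
  rw [norm_sub_sq_real, norm_smul, mul_pow, inner_smul_right, Real.norm_eq_abs, sq_abs, gradHat_eq]
  set c1 := (1 - p) * ind 1 z
  set c2 := p * ind (-1) z
  set c3 := p * (1 - p)
  have b1 : 0 ≤ c1 := mul_nonneg (by linarith) i1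
  have b2 : 0 ≤ c2 := mul_nonneg hp0 i2
  have b3 : 0 ≤ c3 := mul_nonneg hp0 (by linarith)
  have t1 : c1 ≤ 1 := mul_le_one₀ (by linarith) i1 j1
  have t2 : c2 ≤ 1 := mul_le_one₀ hp1 i2 j2
  have t3 : c3 ≤ 1 := mul_le_one₀ hp1 (by linarith) (by linarith)
  set s1 : ℝ := inner ℝ w (z.1 - u)
  set s2 : ℝ := inner ℝ w (z.1 - v)
  set s3 : ℝ := inner ℝ w (v - u)
  have hn := norm_add_three_sq_le ((2 * c1 * s1) • (z.1 - u)) ((2 * c2 * s2) • (z.1 - v))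
    ((2 * c3 * (1 + s3)) • (v - u))
  have n1 := norm_smul_sq_le (s := s1) (norm_sub_le_two hz hu) b1 t1
  have n2 := norm_smul_sq_le (s := s2) (norm_sub_le_two hz hv) b2 t2
  have n3 := norm_smul_sq_le (s := 1 + s3) (norm_sub_le_two hv hu) b3 t3
  simp only [inner_add_right, inner_smul_right]
  set F := c1 * s1 ^ 2 + c2 * s2 ^ 2 + c3 * (1 + s3) ^ 2 with hF
  have hF0 : 0 ≤ F := by positivity
  have hN : ‖(2 * c1 * s1) • (z.1 - u) + (2 * c2 * s2) • (z.1 - v)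
      + (2 * c3 * (1 + s3)) • (v - u)‖ ^ 2 ≤ 48 * κ ^ 2 * F := by
    rw [hF]; linarith
  -- Here `F` is the loss itself. The identity `2 * (1 + s) * s = (1 + s) ^ 2 + s ^ 2 - 1` makes the
  -- inner product of `w` with the gradient at least `F - c3`; the gain `2 * η * F` then cancels the
  -- second-order term, leaving `2 * η * c3`.
  have hI : F - c3 ≤ 2 * c1 * s1 * s1 + 2 * c2 * s2 * s2 + 2 * c3 * (1 + s3) * s3 := by
    have q1 : 0 ≤ c1 * s1 ^ 2 := by positivity
    have q2 : 0 ≤ c2 * s2 ^ 2 := by positivity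
    have q3 : 0 ≤ c3 * s3 ^ 2 := by positivity
    rw [hF]; linarith
  have r1 := mul_le_mul_of_nonneg_left hI hη
  have r2 := mul_le_mul_of_nonneg_left hN (sq_nonneg η)
  have r3 : η ^ 2 * (48 * κ ^ 2 * F) ≤ 2 * (η * F) := by
    have := mul_le_mul_of_nonneg_right hηκ (mul_nonneg hη hF0)
    linarith
  have r4 : η * c3 ≤ η := mul_le_of_le_one_right hη t3
  have e1 : s1 = inner ℝ w (z.1 - u) := rfl
  have e2 : s2 = inner ℝ w (z.1 - v) := rfl
  have e3 : s3 = inner ℝ w (v - u) := rfl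
  rw [← e1, ← e2, ← e3]
  linarith

theorem stepSize_pos {σ t₁ : ℝ} (hσ : 0 < σ) (ht : 0 ≤ t₁) (t : ℕ) : 0 < stepSize σ σ t₁ t := by
  unfold stepSize; positivity

theorem stepSize_eq (σ t₁ : ℝ) (t : ℕ) : stepSize σ σ t₁ t = 2 / (σ * (t + t₁ + 2)) := by
  unfold stepSize; congr 1; ring

theorem inv_succ_le_log (t : ℕ) (ht : 1 ≤ t) :
    1 / ((t : ℝ) + 1) ≤ Real.log (t + 1) - Real.log t := by
  have h0 : (0 : ℝ) < t := by exact_mod_cast ht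
  rw [← Real.log_div (by positivity) h0.ne']
  have := Real.one_sub_inv_le_log_of_pos (show 0 < ((t : ℝ) + 1) / t by positivity)
  refine le_trans (le_of_eq ?_) this
  field_simp
  ring

/-- The iterates grow at most logarithmically. -/
theorem norm_spaucSeq_sq_le {κ σ t₁ : ℝ} (hκ : 1 ≤ κ) (hσ : 0 < σ)
    (ht₁ : 48 * κ ^ 2 ≤ σ * t₁) {z : ℕ → Example d} (hz : ∀ i, ‖(z i).1‖ ≤ κ) (t : ℕ) (ht : 1 ≤ t) :
    ‖spaucSeq (stepSize σ σ t₁) z t‖ ^ 2 ≤ 4 / σ * Real.log t := by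
  have h0 : 0 ≤ t₁ := by
    by_contra! h
    nlinarith
  induction t, ht using Nat.le_induction with
  | base => simp [spaucSeq_one]
  | succ t ht ih =>
    have hη := stepSize_pos hσ h0 t
    have hden : 0 < σ * ((t : ℝ) + t₁ + 2) := by positivity
    have hstep : 24 * κ ^ 2 * stepSize σ σ t₁ t ≤ 1 := by
      rw [stepSize_eq, mul_div_assoc', div_le_one hden]
      nlinarith [mul_nonneg hσ.le (Nat.cast_nonneg (α := ℝ) t)]
    have hk : 0 ≤ κ := by linarith
    have h1 := norm_gradient_step_sq_le (w := spaucSeq (stepSize σ σ t₁) z t) (pHat_nonneg z t)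
      (pHat_le_one z t) (norm_meanHat_le (c := 1) hk hz t) (norm_meanHat_le (c := -1) hk hz t) (hz t)
      hη.le hstep
    have h2 : 2 * stepSize σ σ t₁ t ≤ 4 / σ * (1 / ((t : ℝ) + 1)) := by
      rw [stepSize_eq, div_mul_div_comm, mul_div_assoc', mul_one]
      norm_num
      have : (t : ℝ) + 1 ≤ t + t₁ + 2 := by linarith
      gcongr
    have h3 := mul_le_mul_of_nonneg_left (inv_succ_le_log t ht) (show 0 ≤ 4 / σ by positivity)
    rw [spaucSeq, stochGrad]
    push_cast
    linarith

/-! ### Measurability and dependence on the past -/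

theorem measurable_ind (c : ℝ) : Measurable (ind c : Example d → ℝ) :=
  Measurable.ite (measurable_snd (measurableSet_singleton c)) measurable_const measurable_const

theorem measurable_ind_comp (c : ℝ) {α : Type*} [MeasurableSpace α] {f : α → Example d}
    (hf : Measurable f) : Measurable fun a => ind c (f a) := (measurable_ind c).comp hf

theorem measurable_gradHat {α : Type*} [MeasurableSpace α] {p : α → ℝ} {u v w : α → E d}
    {z : α → Example d} (hp : Measurable p) (hu : Measurable u) (hv : Measurable v)
    (hw : Measurable w) (hz : Measurable z) :
    Measurable fun a => gradHat (p a) (u a) (v a) (w a) (z a) := by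
  have h1 := measurable_ind_comp 1 hz
  have h2 := measurable_ind_comp (-1) hz
  unfold gradHat
  fun_prop

theorem measurable_pHat (t : ℕ) : Measurable fun z : ℕ → Example d => pHat z t := by
  have h (i : ℕ) : Measurable fun z : ℕ → Example d => ind 1 (z i) :=
    measurable_ind_comp 1 (measurable_pi_apply i)
  unfold pHat
  fun_prop

theorem measurable_meanHat (c : ℝ) (t : ℕ) :
    Measurable fun z : ℕ → Example d => meanHat c z t := by
  have h (i : ℕ) : Measurable fun z : ℕ → Example d => ind c (z i) :=
    measurable_ind_comp c (measurable_pi_apply i)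
  unfold meanHat
  fun_prop

theorem measurable_spaucSeq (η : ℕ → ℝ) (t : ℕ) :
    Measurable fun z : ℕ → Example d => spaucSeq η z t := by
  induction t with
  | zero => exact measurable_const
  | succ t ih =>
    simp only [spaucSeq, stochGrad]
    exact ih.sub ((measurable_gradHat (measurable_pHat t) (measurable_meanHat 1 t)
      (measurable_meanHat (-1) t) ih (measurable_pi_apply t)).const_smul (η t))

/-- Makes the iterates predictable: the example used at time `t` is independent of `w t`, so the
noise there is conditionally centered. -/
theorem spaucSeq_congr (η : ℕ → ℝ) {z z' : ℕ → Example d} (t : ℕ) (h : ∀ i < t, z i = z' i) :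
    spaucSeq η z t = spaucSeq η z' t := by
  induction t with
  | zero => rfl
  | succ t ih =>
    have h' : ∀ i < t, z i = z' i := fun i hi => h i (hi.trans t.lt_succ_self)
    have hs (c : ℝ) : ∑ i ∈ Finset.range t, ind c (z i) = ∑ i ∈ Finset.range t, ind c (z' i) :=
      Finset.sum_congr rfl fun i hi => by rw [h' i (Finset.mem_range.1 hi)]
    have hv (c : ℝ) : ∑ i ∈ Finset.range t, ind c (z i) • (z i).1
        = ∑ i ∈ Finset.range t, ind c (z' i) • (z' i).1 :=
      Finset.sum_congr rfl fun i hi => by rw [h' i (Finset.mem_range.1 hi)]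
    simp only [spaucSeq, stochGrad, pHat, meanHat, ih h', hs, hv, h t t.lt_succ_self]

/-! ### Exponential inequalities for nonanticipating sums -/

section Concentration

open ProbabilityTheory
open scoped ENNReal

variable {Ω S : Type*}

/-- The sequence `a` with all entries of index at least `n` replaced by a fixed element. -/
def truncSeq [Nonempty Ω] (n : ℕ) (a : ℕ → Ω) : ℕ → Ω := fun i => if i < n then a i else Classical.arbitrary Ω

theorem truncSeq_apply [Nonempty Ω] {n i : ℕ} (hi : i < n) (a : ℕ → Ω) : truncSeq n a i = a i := if_pos hi

variable [MeasurableSpace Ω] [MeasurableSpace S]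

/-- Hoeffding's lemma on `[-M, M]`. Keeping the compensator inside the exponential lets `M` later
depend on the past. -/
theorem lintegral_exp_sub_le_one {ρ : Measure Ω} [IsProbabilityMeasure ρ] {h : Ω → ℝ} {M : ℝ}
    (hm : Measurable h) (hb : ∀ᵐ b ∂ρ, |h b| ≤ M) (h0 : ∫ b, h b ∂ρ = 0) :
    ∫⁻ b, ENNReal.ofReal (Real.exp (h b - M ^ 2 / 2)) ∂ρ ≤ 1 := by
  have hM : 0 ≤ M := by
    obtain ⟨b, hb⟩ := hb.exists
    exact (abs_nonneg _).trans hb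
  have hs := hasSubgaussianMGF_of_mem_Icc_of_integral_eq_zero hm.aemeasurable
    (hb.mono fun b hb => Set.mem_Icc.2 (abs_le.1 hb)) h0
  have hint : Integrable (fun b => Real.exp (h b - M ^ 2 / 2)) ρ := by
    have := (hs.integrable_exp_mul 1).mul_const (Real.exp (-(M ^ 2 / 2)))
    simpa only [one_mul, ← Real.exp_add, ← sub_eq_add_neg] using this
  rw [← ofReal_integral_eq_lintegral_ofReal hint (ae_of_all _ fun _ => (Real.exp_pos _).le)]
  refine ENNReal.ofReal_le_one.2 ?_
  have h1 := hs.mgf_le 1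
  have hc : (((‖M - -M‖₊ / 2) ^ 2 : NNReal) : ℝ) = M ^ 2 := by
    push_cast
    rw [Real.norm_eq_abs, sub_neg_eq_add, ← two_mul, abs_of_nonneg (by positivity)]
    ring
  rw [hc, mgf] at h1
  simp only [one_mul, one_pow, mul_one] at h1
  simp only [Real.exp_sub, integral_div]
  exact (div_le_one (Real.exp_pos _)).2 h1

variable [Nonempty Ω]

theorem measurable_truncSeq_comp {z : ℕ → S → Ω} (hz : ∀ i, Measurable (z i)) (n : ℕ) :
    Measurable fun s => truncSeq n fun i => z i s := by
  refine measurable_pi_lambda _ fun i => ?_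
  unfold truncSeq
  split_ifs
  · exact hz i
  · exact measurable_const

/-- Nonanticipating factors are functions of a whole sequence. Freezing the entries from `n` on does
not change them and turns the sequence into a function of `z 0, …, z (n - 1)`, to which independence
applies. -/
theorem indepFun_truncSeq {μ : Measure S} {z : ℕ → S → Ω} (hz : ∀ i, Measurable (z i))
    (hind : iIndepFun z μ) (n : ℕ) : IndepFun (fun s => truncSeq n fun i => z i s) (z n) μ := by
  have h := hind.indepFun_finset (Finset.range n) {n} (by simp) hz
  let F : (Finset.range n → Ω) → ℕ → Ω := fun a i =>
    if h : i < n then a ⟨i, Finset.mem_range.2 h⟩ else Classical.arbitrary Ω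
  have hF : Measurable F := by
    refine measurable_pi_lambda _ fun i => ?_
    by_cases hi : i < n
    · simpa only [F, hi, dite_true] using measurable_pi_apply _
    · simpa only [F, hi, dite_false] using measurable_const
  have hG : Measurable fun a : ({n} : Finset ℕ) → Ω => a ⟨n, Finset.mem_singleton_self n⟩ :=
    measurable_pi_apply _
  exact h.comp hF hG

/-- The expectation of a product of nonanticipating factors with conditional expectations at most
one is at most one. -/
theorem lintegral_prod_le_one {μ : Measure S} [IsProbabilityMeasure μ] {ρ : Measure Ω}
    [IsProbabilityMeasure ρ] {z : ℕ → S → Ω} (hz : ∀ i, Measurable (z i)) (hind : iIndepFun z μ)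
    (hlaw : ∀ i, μ.map (z i) = ρ) {Ψ : ℕ → (ℕ → Ω) → Ω → ℝ≥0∞}
    (hΨ : ∀ k, Measurable fun q : (ℕ → Ω) × Ω => Ψ k q.1 q.2)
    (hpast : ∀ k a a', (∀ i < k, a i = a' i) → Ψ k a = Ψ k a')
    (hle : ∀ k a, ∫⁻ b, Ψ k a b ∂ρ ≤ 1) (m n : ℕ) :
    ∫⁻ s, ∏ k ∈ Finset.Ico m n, Ψ k (fun i => z i s) (z k s) ∂μ ≤ 1 := by
  rcases lt_or_ge n m with hnm | hmn
  · simp [Finset.Ico_eq_empty_of_le hnm.le]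
  induction n, hmn using Nat.le_induction with
  | base => simp
  | succ n hmn ih =>
    let P : (ℕ → Ω) → ℝ≥0∞ := fun a => ∏ k ∈ Finset.Ico m n, Ψ k a (a k)
    have hP : Measurable P := Finset.measurable_prod _ fun k _ =>
      (hΨ k).comp (measurable_id.prodMk (measurable_pi_apply k))
    have htr := measurable_truncSeq_comp hz n
    have hΨP : Measurable fun q : (ℕ → Ω) × Ω => P q.1 * Ψ n q.1 q.2 :=
      (hP.comp measurable_fst).mul (hΨ n)
    have hPt (s : S) : P (truncSeq n fun i => z i s)
        = ∏ k ∈ Finset.Ico m n, Ψ k (fun i => z i s) (z k s) := by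
      refine Finset.prod_congr rfl fun k hk => ?_
      have hk := (Finset.mem_Ico.1 hk).2
      rw [truncSeq_apply hk, hpast k _ (fun i => z i s) fun i hi => truncSeq_apply (hi.trans hk) _]
    calc ∫⁻ s, ∏ k ∈ Finset.Ico m (n + 1), Ψ k (fun i => z i s) (z k s) ∂μ
        = ∫⁻ s, (fun q : (ℕ → Ω) × Ω => P q.1 * Ψ n q.1 q.2)
            (truncSeq n fun i => z i s, z n s) ∂μ := by
          refine lintegral_congr fun s => ?_
          rw [Finset.prod_Ico_succ_top hmn]
          simp only [hPt]
          rw [hpast n (truncSeq n fun i => z i s) (fun i => z i s) fun i hi => truncSeq_apply hi _]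
      _ = ∫⁻ q, P q.1 * Ψ n q.1 q.2 ∂(μ.map fun s => truncSeq n fun i => z i s).prod ρ := by
          rw [← hlaw n, ← (indepFun_truncSeq hz hind n).map_prod_eq_prod_map_map htr.aemeasurable
            (hz n).aemeasurable, lintegral_map hΨP (htr.prodMk (hz n))]
      _ = ∫⁻ a, ∫⁻ b, P a * Ψ n a b ∂ρ ∂(μ.map fun s => truncSeq n fun i => z i s) :=
          lintegral_prod _ hΨP.aemeasurable
      _ ≤ ∫⁻ a, P a ∂(μ.map fun s => truncSeq n fun i => z i s) := by
          refine lintegral_mono fun a => ?_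
          have hm : Measurable (Ψ n a) := (hΨ n).comp (measurable_const.prodMk measurable_id)
          rw [lintegral_const_mul _ hm]
          exact mul_le_of_le_one_right' (hle n a)
      _ = ∫⁻ s, ∏ k ∈ Finset.Ico m n, Ψ k (fun i => z i s) (z k s) ∂μ := by
          rw [lintegral_map hP htr]
          exact lintegral_congr hPt
      _ ≤ 1 := ih

/-- A deviation inequality for sums of conditionally centered nonanticipating terms, with
predictable bounds `M`. -/
theorem measure_sum_ge_le {μ : Measure S} [IsProbabilityMeasure μ] {ρ : Measure Ω}
    [IsProbabilityMeasure ρ] {z : ℕ → S → Ω} (hz : ∀ i, Measurable (z i)) (hind : iIndepFun z μ)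
    (hlaw : ∀ i, μ.map (z i) = ρ) {h : ℕ → (ℕ → Ω) → Ω → ℝ} {M : ℕ → (ℕ → Ω) → ℝ}
    (hh : ∀ k, Measurable fun q : (ℕ → Ω) × Ω => h k q.1 q.2) (hM : ∀ k, Measurable (M k))
    (hpast : ∀ k a a', (∀ i < k, a i = a' i) → h k a = h k a' ∧ M k a = M k a')
    (hb : ∀ k a, ∀ᵐ b ∂ρ, |h k a b| ≤ M k a) (h0 : ∀ k a, ∫ b, h k a b ∂ρ = 0) (m n : ℕ) (L : ℝ) :
    μ {s | (∑ k ∈ Finset.Ico m n, M k (fun i => z i s) ^ 2) / 2 + L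
      ≤ ∑ k ∈ Finset.Ico m n, h k (fun i => z i s) (z k s)} ≤ ENNReal.ofReal (Real.exp (-L)) := by
  let Ψ : ℕ → (ℕ → Ω) → Ω → ℝ≥0∞ := fun k a b => ENNReal.ofReal (Real.exp (h k a b - M k a ^ 2 / 2))
  have hΨ (k : ℕ) : Measurable fun q : (ℕ → Ω) × Ω => Ψ k q.1 q.2 := by
    have h1 := hh k
    have h2 : Measurable fun q : (ℕ → Ω) × Ω => M k q.1 := (hM k).comp measurable_fst
    simp only [Ψ]
    fun_prop
  have hpastΨ : ∀ k a a', (∀ i < k, a i = a' i) → Ψ k a = Ψ k a' := by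
    intro k a a' haa
    simp only [Ψ, (hpast k a a' haa).1, (hpast k a a' haa).2]
  have hz' : Measurable fun s (i : ℕ) => z i s := measurable_pi_lambda _ hz
  have hle := lintegral_prod_le_one hz hind hlaw hΨ hpastΨ (fun k a =>
    lintegral_exp_sub_le_one ((hh k).comp (measurable_const.prodMk measurable_id)) (hb k a) (h0 k a))
    m n
  have hmeas : Measurable fun s => ∏ k ∈ Finset.Ico m n, Ψ k (fun i => z i s) (z k s) :=
    Finset.measurable_prod _ fun k _ => (hΨ k).comp (hz'.prodMk (hz k))
  have hL : ENNReal.ofReal (Real.exp L) ≠ 0 := by simpa using Real.exp_pos L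
  refine (measure_mono ?_).trans ((meas_ge_le_lintegral_div hmeas.aemeasurable hL
    ENNReal.ofReal_ne_top).trans ?_)
  · intro s hs
    have hs : (∑ k ∈ Finset.Ico m n, M k (fun i => z i s) ^ 2) / 2 + L
      ≤ ∑ k ∈ Finset.Ico m n, h k (fun i => z i s) (z k s) := hs
    change _ ≤ ∏ k ∈ Finset.Ico m n, ENNReal.ofReal _
    rw [← ENNReal.ofReal_prod_of_nonneg fun _ _ => (Real.exp_pos _).le, ← Real.exp_sum]
    refine ENNReal.ofReal_le_ofReal (Real.exp_le_exp.2 ?_)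
    rw [Finset.sum_sub_distrib, ← Finset.sum_div]
    linarith
  · rw [Real.exp_neg, ENNReal.ofReal_inv_of_pos (Real.exp_pos L), ← one_div]
    exact ENNReal.div_le_div_right hle _

/-- A one-sided deviation inequality for averages of bounded independent variables. -/
theorem measure_sum_sub_integral_ge_le {μ : Measure S} [IsProbabilityMeasure μ] {ρ : Measure Ω}
    [IsProbabilityMeasure ρ] {z : ℕ → S → Ω} (hz : ∀ i, Measurable (z i)) (hind : iIndepFun z μ)
    (hlaw : ∀ i, μ.map (z i) = ρ) {g : Ω → ℝ} {B : ℝ} (hg : Measurable g)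
    (hB : ∀ᵐ b ∂ρ, |g b| ≤ B) {t : ℕ} (ht : 1 ≤ t) (L : ℝ) :
    μ {s | √t * (2 * B ^ 2 + L) ≤ ∑ i ∈ Finset.range t, (g (z i s) - ∫ b, g b ∂ρ)}
      ≤ ENNReal.ofReal (Real.exp (-L)) := by
  have ht0 : (0 : ℝ) < t := by exact_mod_cast ht
  have hst : 0 < √(t : ℝ) := Real.sqrt_pos.2 ht0
  have hint : Integrable g ρ :=
    Integrable.of_bound hg.aestronglyMeasurable B (hB.mono fun b hb => by simpa using hb)
  have hm : |∫ b, g b ∂ρ| ≤ B := by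
    have h1 : ∀ᵐ b ∂ρ, ‖g b‖ ≤ B := hB
    simpa using norm_integral_le_of_norm_le_const h1
  -- The scaling by `1 / √t` makes half the sum of the squared bounds equal to `2 * B ^ 2`,
  -- independently of `t`.
  have key := measure_sum_ge_le hz hind hlaw
    (h := fun _ _ b => (√(t : ℝ))⁻¹ * (g b - ∫ b, g b ∂ρ)) (M := fun _ _ => (√(t : ℝ))⁻¹ * (2 * B))
    (fun _ => ((hg.comp measurable_snd).sub_const _).const_mul _) (fun _ => measurable_const)
    (fun _ _ _ _ => ⟨rfl, rfl⟩) (fun _ _ => hB.mono fun b hb => by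
      rw [abs_mul, abs_of_pos (inv_pos.2 hst)]
      gcongr
      exact (abs_sub _ _).trans (by linarith)) (fun _ _ => by
      rw [integral_const_mul, integral_sub hint (integrable_const _)]
      simp) 0 t L
  refine (measure_mono fun s hs => ?_).trans key
  have hs : √(t : ℝ) * (2 * B ^ 2 + L) ≤ ∑ i ∈ Finset.range t, (g (z i s) - ∫ b, g b ∂ρ) := hs
  rw [Set.mem_ofPred_eq, ← Finset.range_eq_Ico, ← Finset.mul_sum, Finset.sum_const, Finset.card_range, nsmul_eq_mul,
    inv_mul_eq_div _ (Finset.sum _ _), le_div_iff₀ hst]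
  refine le_trans (le_of_eq ?_) hs
  rw [mul_pow, inv_pow, Real.sq_sqrt ht0.le]
  field_simp

end Concentration

/-! ### Convex quadratic functions -/

section Quadratic

/-- A nonnegative quadratic function with positive semidefinite symmetric part attains its
minimum. -/
theorem exists_quadratic_center {A : E d →ₗ[ℝ] E d} (hA : A.IsSymmetric)
    {f : E d → ℝ} {b : E d} {c : ℝ} (hf : ∀ w, f w = c + inner ℝ w b + inner ℝ w (A w))
    (hf0 : ∀ w, 0 ≤ f w) : ∃ w₀, ∀ w, f w = f w₀ + inner ℝ (w - w₀) (A (w - w₀)) := by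
  have hb : b ∈ LinearMap.range A := by
    have h1 : (LinearMap.range A)ᗮᗮ = LinearMap.range A := Submodule.orthogonal_orthogonal _
    rw [← h1, hA.orthogonal_range, Submodule.mem_orthogonal]
    intro k hk
    by_contra hne
    rw [LinearMap.mem_ker] at hk
    -- On `ker A` the function is affine, and at this multiple of `k` it would equal `-1`.
    have h2 := hf0 ((-(c + 1) / inner ℝ k b) • k)
    rw [hf, map_smul, hk, smul_zero, inner_zero_right, real_inner_smul_left,
      div_mul_cancel₀ _ hne] at h2
    linarith
  obtain ⟨a, ha⟩ := hb
  have key : ∀ w, f w = c + inner ℝ w (A a) + inner ℝ w (A w) := by rw [ha]; exact hf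
  refine ⟨(-(1 / 2) : ℝ) • a, fun w => ?_⟩
  rw [key, key]
  have h3 : inner ℝ a (A w) = inner ℝ w (A a) := by rw [← hA, real_inner_comm]
  simp only [map_sub, map_smul, inner_sub_left, inner_sub_right, real_inner_smul_left,
    real_inner_smul_right, h3]
  ring

variable {A : E d →ₗ[ℝ] E d} {f : E d → ℝ} {w₀ : E d}

theorem map_eq_zero_of_inner_eq_zero (hA : A.IsSymmetric) (hA0 : ∀ h, 0 ≤ inner ℝ h (A h)) {h : E d}
    (hh : inner ℝ h (A h) = 0) : A h = 0 := by
  by_contra hne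
  have hpos : 0 < ‖A h‖ ^ 2 := by positivity
  set q : ℝ := inner ℝ (A h) (A (A h)) with hq
  have hq0 : 0 ≤ q := hA0 _
  -- A descent step along `A h` would make the form negative; the denominator `q + 1` replaces the
  -- optimal `q`, which may vanish.
  have h1 := hA0 (h + (-(‖A h‖ ^ 2) / (q + 1)) • A h)
  have h2 : inner ℝ h (A (A h)) = ‖A h‖ ^ 2 := by rw [← hA, real_inner_self_eq_norm_sq]
  have h3 : inner ℝ (A h) (A h) = ‖A h‖ ^ 2 := real_inner_self_eq_norm_sq _
  simp only [map_add, map_smul, inner_add_left, inner_add_right, real_inner_smul_left,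
    real_inner_smul_right, hh, h2, h3, ← hq] at h1
  have h4 : (-(‖A h‖ ^ 2) / (q + 1)) * ((-(‖A h‖ ^ 2) / (q + 1)) * q)
      + 2 * ((-(‖A h‖ ^ 2) / (q + 1)) * ‖A h‖ ^ 2)
      = -((‖A h‖ ^ 2) ^ 2 * (q + 2)) / (q + 1) ^ 2 := by
    field_simp
    ring
  have h5 : -((‖A h‖ ^ 2) ^ 2 * (q + 2)) / (q + 1) ^ 2 < 0 :=
    div_neg_of_neg_of_pos (neg_neg_of_pos (by positivity)) (by positivity)
  linarith

theorem mem_solSet_iff (hA : A.IsSymmetric) (hA0 : ∀ h, 0 ≤ inner ℝ h (A h))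
    (hf : ∀ w, f w = f w₀ + inner ℝ (w - w₀) (A (w - w₀))) {w : E d} :
    w ∈ solSet f ↔ w - w₀ ∈ LinearMap.ker A := by
  rw [LinearMap.mem_ker]
  constructor
  · intro hw
    have h1 := hw w₀
    have h2 := hf w
    exact map_eq_zero_of_inner_eq_zero hA hA0 (le_antisymm (by linarith) (hA0 _))
  · intro hw v
    rw [hf w, hw, inner_zero_right, hf v]
    linarith [hA0 (v - w₀)]

/-- The nearest point to `w` in the affine subspace through `w₀` with direction `ker A`. -/
def projKer (A : E d →ₗ[ℝ] E d) (w₀ w : E d) : E d :=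
  w₀ + (LinearMap.ker A).starProjection (w - w₀)

theorem continuous_projKer (A : E d →ₗ[ℝ] E d) (w₀ : E d) : Continuous (projKer A w₀) := by
  unfold projKer; fun_prop

theorem sub_projKer_mem (A : E d →ₗ[ℝ] E d) (w₀ w : E d) :
    w - projKer A w₀ w ∈ (LinearMap.ker A)ᗮ := by
  have := (LinearMap.ker A).sub_starProjection_mem_orthogonal (w - w₀)
  rwa [sub_sub] at this

theorem projKer_mem_solSet (hA : A.IsSymmetric) (hA0 : ∀ h, 0 ≤ inner ℝ h (A h))
    (hf : ∀ w, f w = f w₀ + inner ℝ (w - w₀) (A (w - w₀))) (w : E d) :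
    projKer A w₀ w ∈ solSet f := by
  rw [mem_solSet_iff hA hA0 hf, projKer, add_sub_cancel_left]
  exact Submodule.starProjection_apply_mem _ _

/-- The minimizers form the affine subspace through `w₀` with direction `ker A`, so Pythagoras gives
both minimality and uniqueness. -/
theorem isProj_iff_eq_projKer (hA : A.IsSymmetric) (hA0 : ∀ h, 0 ≤ inner ℝ h (A h))
    (hf : ∀ w, f w = f w₀ + inner ℝ (w - w₀) (A (w - w₀))) {w v : E d} :
    IsProj (solSet f) w v ↔ v = projKer A w₀ w := by
  have pyth : ∀ u ∈ solSet f,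
      ‖w - u‖ ^ 2 = ‖w - projKer A w₀ w‖ ^ 2 + ‖projKer A w₀ w - u‖ ^ 2 := by
    intro u hu
    have h1 : projKer A w₀ w - u ∈ LinearMap.ker A := by
      have := sub_mem ((mem_solSet_iff hA hA0 hf).1 (projKer_mem_solSet hA hA0 hf w))
        ((mem_solSet_iff hA hA0 hf).1 hu)
      rwa [sub_sub_sub_cancel_right] at this
    have h2 := (Submodule.mem_orthogonal' _ _).1 (sub_projKer_mem A w₀ w) _ h1
    rw [← sub_add_sub_cancel w (projKer A w₀ w) u, norm_add_sq_real, h2]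
    ring
  constructor
  · rintro ⟨hv, hmin⟩
    have h1 := pow_le_pow_left₀ (norm_nonneg _) (hmin _ (projKer_mem_solSet hA hA0 hf w)) 2
    have h2 := pyth v hv
    have h3 : ‖projKer A w₀ w - v‖ ^ 2 = 0 := le_antisymm (by linarith) (sq_nonneg _)
    exact (sub_eq_zero.1 (norm_eq_zero.1 (pow_eq_zero_iff two_ne_zero |>.1 h3))).symm
  · rintro rfl
    refine ⟨projKer_mem_solSet hA hA0 hf w, fun u hu => ?_⟩
    refine le_of_sq_le_sq ?_ (norm_nonneg _)
    rw [pyth u hu]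
    linarith [sq_nonneg ‖projKer A w₀ w - u‖]

/-- The form vanishes only on `ker A`, so its minimum over the compact set of unit vectors
orthogonal to `ker A` is positive, and homogeneity does the rest. -/
theorem exists_quadraticGrowth (hA : A.IsSymmetric) (hA0 : ∀ h, 0 ≤ inner ℝ h (A h))
    (hf : ∀ w, f w = f w₀ + inner ℝ (w - w₀) (A (w - w₀))) : ∃ σ, QuadraticGrowth f σ := by
  have hAc : Continuous A := A.continuous_of_finiteDimensional
  let s : Set (E d) := Metric.sphere 0 1 ∩ (LinearMap.ker A)ᗮ
  have hs : IsCompact s := (isCompact_sphere 0 1).inter_right (Submodule.isClosed_orthogonal _)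
  obtain ⟨σ, hσ, hle⟩ : ∃ σ : ℝ, 0 < σ ∧ ∀ h ∈ s, σ ≤ inner ℝ h (A h) := by
    rcases s.eq_empty_or_nonempty with he | hne
    · exact ⟨1, one_pos, by simp [he]⟩
    obtain ⟨a, ha, hmin⟩ := hs.exists_isMinOn hne
      (continuous_id.inner hAc : Continuous fun h : E d => inner ℝ h (A h)).continuousOn
    refine ⟨inner ℝ a (A a), lt_of_le_of_ne (hA0 a) fun h0 => ?_, fun h hh => hmin hh⟩
    have hk : a ∈ LinearMap.ker A := map_eq_zero_of_inner_eq_zero hA hA0 h0.symm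
    have h1 := (Submodule.mem_orthogonal _ _).1 ha.2 a hk
    rw [inner_self_eq_zero] at h1
    have h2 := mem_sphere_zero_iff_norm.1 ha.1
    simp [h1] at h2
  have hle' : ∀ h ∈ (LinearMap.ker A)ᗮ, σ * ‖h‖ ^ 2 ≤ inner ℝ h (A h) := by
    intro h hh
    by_cases h0 : h = 0
    · simp [h0]
    have hn : 0 < ‖h‖ := norm_pos_iff.2 h0
    have h1 := hle (‖h‖⁻¹ • h) ⟨by simp [norm_smul, hn.ne'], Submodule.smul_mem _ _ hh⟩
    rw [map_smul, real_inner_smul_left, real_inner_smul_right, ← mul_assoc, ← mul_inv,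
      inv_mul_eq_div, le_div_iff₀ (by positivity)] at h1
    linarith
  refine ⟨σ, hσ, fun w v hv => ?_⟩
  obtain rfl := (isProj_iff_eq_projKer hA hA0 hf).1 hv
  have h1 := hle' _ (sub_projKer_mem A w₀ w)
  have h2 := (projKer_mem_solSet hA hA0 hf w) w₀
  have h3 : A (projKer A w₀ w - w₀) = 0 :=
    (mem_solSet_iff hA hA0 hf).1 (projKer_mem_solSet hA hA0 hf w)
  have h4 : A (w - projKer A w₀ w) = A (w - w₀) := by
    rw [← sub_sub_sub_cancel_right w _ w₀, map_sub, h3, sub_zero]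
  have h5 : inner ℝ (w - projKer A w₀ w) (A (w - projKer A w₀ w))
      = inner ℝ (w - w₀) (A (w - w₀)) := by
    rw [h4, ← sub_sub_sub_cancel_right w _ w₀, inner_sub_left, ← hA (projKer A w₀ w - w₀), h3,
      inner_zero_left, sub_zero]
  rw [hf w]
  linarith

end Quadratic

/-! ### The population objective -/

/-- The probability of the label `c`, as an expectation. -/
def classProb (ρ : Measure (Example d)) (c : ℝ) : ℝ := ∫ z, ind c z ∂ρ

/-- The expectation of `x 𝟙[y = c]`. -/
def classMom (ρ : Measure (Example d)) (c : ℝ) : E d := ∫ z, ind c z • z.1 ∂ρ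

/-- The conditional mean of the input given the label `c`. -/
def classMean (ρ : Measure (Example d)) (c : ℝ) : E d := (classProb ρ c)⁻¹ • classMom ρ c

/-- The gradient of the loss with the population parameters. -/
def gradPop (ρ : Measure (Example d)) (w : E d) (z : Example d) : E d :=
  gradHat (posProb ρ) (classMean ρ 1) (classMean ρ (-1)) w z

/-- The loss with the population parameters. -/
def lossPop (ρ : Measure (Example d)) (w : E d) (z : Example d) : ℝ :=
  lossHat (posProb ρ) (classMean ρ 1) (classMean ρ (-1)) w z

/-- The gradient of the risk. -/
def riskGrad (ρ : Measure (Example d)) (w : E d) : E d := ∫ z, gradPop ρ w z ∂ρ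

variable {ρ : Measure (Example d)} {κ : ℝ}

theorem classProb_eq_real (c : ℝ) : classProb ρ c = ρ.real {z | z.2 = c} := by
  have h : MeasurableSet {z : Example d | z.2 = c} := measurable_snd (measurableSet_singleton c)
  rw [← integral_indicator_one h, classProb]
  congr 1

theorem classProb_one : classProb ρ 1 = posProb ρ := classProb_eq_real 1

theorem classProb_smul_classMean {c : ℝ} (hc : classProb ρ c ≠ 0) :
    classProb ρ c • classMean ρ c = classMom ρ c := by
  rw [classMean, smul_inv_smul₀ hc]

theorem measurable_gradPop (w : E d) : Measurable (gradPop ρ w) :=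
  measurable_gradHat measurable_const measurable_const measurable_const measurable_const measurable_id

/-- The standing assumptions on the data distribution, for inputs bounded by `κ`. -/
structure GoodLaw (ρ : Measure (Example d)) (κ : ℝ) : Prop where
  one_le : 1 ≤ κ
  bound : ∀ᵐ z ∂ρ, ‖z.1‖ ≤ κ
  label : ∀ᵐ z ∂ρ, z.2 = 1 ∨ z.2 = -1
  pos : 0 < posProb ρ
  lt_one : posProb ρ < 1

theorem risk_nonneg (h : GoodLaw ρ κ) (w : E d) : 0 ≤ risk ρ w :=
  mul_nonneg (mul_nonneg h.pos.le (by linarith [h.lt_one])) (integral_nonneg fun _ => sq_nonneg _)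

theorem GoodLaw.classProb_one_pos (h : GoodLaw ρ κ) : 0 < classProb ρ 1 := by
  rw [classProb_one]; exact h.pos

variable [IsProbabilityMeasure ρ]

theorem ind_add_ind {z : Example d} (hz : z.2 = 1 ∨ z.2 = -1) : ind 1 z + ind (-1) z = 1 := by
  unfold ind
  rcases hz with h | h <;> rw [h] <;> norm_num

theorem integrable_ind (c : ℝ) : Integrable (ind c) ρ :=
  Integrable.of_bound (measurable_ind c).aestronglyMeasurable 1
    (ae_of_all _ fun z => abs_ind_le_one c z)

theorem classProb_neg_one (hl : ∀ᵐ z ∂ρ, z.2 = 1 ∨ z.2 = -1) :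
    classProb ρ (-1) = 1 - posProb ρ := by
  have h : ∫ z, (ind 1 z + ind (-1) z) ∂ρ = ∫ _, (1 : ℝ) ∂ρ :=
    integral_congr_ae (hl.mono fun z hz => ind_add_ind hz)
  rw [integral_add (integrable_ind 1) (integrable_ind (-1))] at h
  simp only [integral_const, probReal_univ, smul_eq_mul, mul_one] at h
  have h1 : ∫ z, ind 1 z ∂ρ = posProb ρ := classProb_one
  rw [classProb]
  linarith

theorem norm_ind_smul_le (c : ℝ) {κ : ℝ} {z : Example d} (hz : ‖z.1‖ ≤ κ) :
    ‖ind c z • z.1‖ ≤ ind c z * κ := by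
  rw [norm_smul, Real.norm_eq_abs, abs_of_nonneg (ind_nonneg c z)]
  exact mul_le_mul_of_nonneg_left hz (ind_nonneg c z)

theorem measurable_ind_smul (c : ℝ) : Measurable fun z : Example d => ind c z • z.1 :=
  (measurable_ind c).smul measurable_fst

theorem integrable_ind_smul (c : ℝ) {κ : ℝ} (hκ : ∀ᵐ z ∂ρ, ‖z.1‖ ≤ κ) :
    Integrable (fun z : Example d => ind c z • z.1) ρ :=
  ((integrable_ind c).mul_const κ).mono' (measurable_ind_smul c).aestronglyMeasurable
    (hκ.mono fun _ hz => norm_ind_smul_le c hz)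

theorem norm_classMean_le {c κ : ℝ} (hκ : ∀ᵐ z ∂ρ, ‖z.1‖ ≤ κ) (hc : 0 < classProb ρ c) :
    ‖classMean ρ c‖ ≤ κ := by
  have h1 : ‖classMom ρ c‖ ≤ classProb ρ c * κ := by
    rw [classProb, ← integral_mul_const]
    exact norm_integral_le_of_norm_le ((integrable_ind c).mul_const κ)
      (hκ.mono fun _ hz => norm_ind_smul_le c hz)
  rw [classMean, norm_smul, norm_inv, Real.norm_eq_abs, abs_of_pos hc, inv_mul_le_iff₀ hc]
  exact h1

theorem integrable_ind_mul_inner_pow (c : ℝ) {κ : ℝ} (hκ : ∀ᵐ z ∂ρ, ‖z.1‖ ≤ κ) (w : E d) (n : ℕ) :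
    Integrable (fun z : Example d => ind c z * inner ℝ w z.1 ^ n) ρ := by
  have hm : Measurable fun z : Example d => ind c z * inner ℝ w z.1 ^ n := by
    have := measurable_ind (d := d) c
    fun_prop
  refine Integrable.of_bound hm.aestronglyMeasurable (1 * (‖w‖ * κ) ^ n) (hκ.mono fun z hz => ?_)
  rw [norm_mul, norm_pow, Real.norm_eq_abs, Real.norm_eq_abs]
  refine mul_le_mul (abs_ind_le_one c z) (pow_le_pow_left₀ (abs_nonneg _) ?_ n) (by positivity)
    zero_le_one
  exact (abs_real_inner_le_norm _ _).trans (mul_le_mul_of_nonneg_left hz (norm_nonneg _))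

theorem integral_ind_mul_inner {c κ : ℝ} (hκ : ∀ᵐ z ∂ρ, ‖z.1‖ ≤ κ) (hc : classProb ρ c ≠ 0)
    (w : E d) : ∫ z, ind c z * inner ℝ w z.1 ∂ρ = classProb ρ c * inner ℝ w (classMean ρ c) := by
  rw [← real_inner_smul_right, classProb_smul_classMean hc, classMom,
    ← integral_inner (integrable_ind_smul c hκ)]
  simp only [real_inner_smul_right]

theorem integrable_and_integral_add {α : Type*} [MeasurableSpace α] {μ : Measure α} {f g : α → ℝ}
    {a b : ℝ} (hf : Integrable f μ ∧ ∫ x, f x ∂μ = a) (hg : Integrable g μ ∧ ∫ x, g x ∂μ = b) :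
    Integrable (fun x => f x + g x) μ ∧ ∫ x, (f x + g x) ∂μ = a + b :=
  ⟨hf.1.add hg.1, by rw [integral_add hf.1 hg.1, hf.2, hg.2]⟩

theorem integrable_and_integral_const_mul {α : Type*} [MeasurableSpace α] {μ : Measure α}
    {f : α → ℝ} {a : ℝ} (c : ℝ) (hf : Integrable f μ ∧ ∫ x, f x ∂μ = a) :
    Integrable (fun x => c * f x) μ ∧ ∫ x, c * f x ∂μ = c * a :=
  ⟨hf.1.const_mul c, by rw [integral_const_mul, hf.2]⟩

theorem integrable_and_integral_mul_prod {f g : Example d → ℝ} {a b : ℝ}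
    (hf : Integrable f ρ ∧ ∫ x, f x ∂ρ = a) (hg : Integrable g ρ ∧ ∫ x, g x ∂ρ = b) :
    Integrable (fun q : Example d × Example d => f q.1 * g q.2) (ρ.prod ρ) ∧
      ∫ q : Example d × Example d, f q.1 * g q.2 ∂ρ.prod ρ = a * b :=
  ⟨hf.1.mul_prod hg.1, by rw [integral_prod_mul, hf.2, hg.2]⟩

theorem risk_eq_integral_prod (hl : ∀ᵐ z ∂ρ, z.2 = 1 ∨ z.2 = -1)
    (hp : 0 < posProb ρ ∧ posProb ρ < 1) (w : E d) :
    risk ρ w = ∫ q : Example d × Example d,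
      ind 1 q.1 * ind (-1) q.2 * (1 - inner ℝ w (q.1.1 - q.2.1)) ^ 2 ∂ρ.prod ρ := by
  have hm1 : MeasurableSet {z : Example d | z.2 = 1} := measurable_snd (measurableSet_singleton 1)
  have hm2 : MeasurableSet {z : Example d | z.2 = -1} :=
    measurable_snd (measurableSet_singleton (-1))
  have hset : {q : Example d × Example d | q.1.2 = 1 ∧ q.2.2 = -1}
      = {z : Example d | z.2 = 1} ×ˢ {z : Example d | z.2 = -1} := rfl
  have hms : MeasurableSet {q : Example d × Example d | q.1.2 = 1 ∧ q.2.2 = -1} := hm1.prod hm2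
  have hreal : (ρ.prod ρ).real {q : Example d × Example d | q.1.2 = 1 ∧ q.2.2 = -1}
      = posProb ρ * (1 - posProb ρ) := by
    rw [hset, measureReal_prod_prod, ← classProb_neg_one hl, classProb_eq_real, posProb]
  have hne : posProb ρ * (1 - posProb ρ) ≠ 0 := mul_ne_zero hp.1.ne' (by linarith)
  rw [risk, ProbabilityTheory.cond, integral_smul_measure, ENNReal.toReal_inv, ← measureReal_def,
    hreal, smul_eq_mul, mul_inv_cancel_left₀ hne, ← integral_indicator hms]
  refine integral_congr_ae (ae_of_all _ fun q => ?_)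
  by_cases h1 : q.1.2 = 1 <;> by_cases h2 : q.2.2 = -1 <;> simp [ind, Set.indicator, h1, h2]


/-- Independence of the two examples reduces the pair expectation to first and second class moments,
which a loss of one example reproduces once the class means are known. This makes `gradPop`
unbiased. -/
theorem risk_eq_integral_lossPop {κ : ℝ} (hκ : ∀ᵐ z ∂ρ, ‖z.1‖ ≤ κ)
    (hl : ∀ᵐ z ∂ρ, z.2 = 1 ∨ z.2 = -1) (hp : 0 < posProb ρ ∧ posProb ρ < 1) (w : E d) :
    Integrable (lossPop ρ w) ρ ∧ risk ρ w = ∫ z, lossPop ρ w z ∂ρ := by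
  have hc1 : classProb ρ 1 ≠ 0 := by rw [classProb_one]; exact hp.1.ne'
  have hc2 : classProb ρ (-1) ≠ 0 := by rw [classProb_neg_one hl]; linarith
  have a0 := integrable_ind (ρ := ρ) 1
  have a1 : Integrable (fun z : Example d => ind 1 z * inner ℝ w z.1) ρ := by
    simpa using integrable_ind_mul_inner_pow 1 hκ w 1
  have a2 := integrable_ind_mul_inner_pow 1 hκ w 2
  have b0 := integrable_ind (ρ := ρ) (-1)
  have b1 : Integrable (fun z : Example d => ind (-1) z * inner ℝ w z.1) ρ := by
    simpa using integrable_ind_mul_inner_pow (-1) hκ w 1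
  have b2 := integrable_ind_mul_inner_pow (-1) hκ w 2
  have e0 : ∫ z, ind 1 z ∂ρ = posProb ρ := classProb_one
  have f0 : ∫ z, ind (-1) z ∂ρ = 1 - posProb ρ := classProb_neg_one hl
  have e1 := integral_ind_mul_inner hκ hc1 w
  have f1 := integral_ind_mul_inner hκ hc2 w
  rw [classProb_one] at e1
  rw [classProb_neg_one hl] at f1
  set p := posProb ρ with hpdef
  set U : ℝ := inner ℝ w (classMean ρ 1) with hU
  set V : ℝ := inner ℝ w (classMean ρ (-1)) with hV
  have hloss : lossPop ρ w = fun z => (1 - p) * (ind 1 z * inner ℝ w z.1 ^ 2)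
      + (-2 * (1 - p) * U) * (ind 1 z * inner ℝ w z.1) + (1 - p) * U ^ 2 * ind 1 z
      + p * (ind (-1) z * inner ℝ w z.1 ^ 2) + (-2 * p * V) * (ind (-1) z * inner ℝ w z.1)
      + p * V ^ 2 * ind (-1) z
      + (2 * p * (1 - p) * (V - U) + p * (1 - p) * (V - U) ^ 2 + p * (1 - p)) := by
    funext z
    simp only [lossPop, lossHat, inner_sub_right]
    rw [← hU, ← hV, ← hpdef]
    ring
  have A0 : Integrable (ind 1) ρ ∧ ∫ z, ind 1 z ∂ρ = p := ⟨a0, e0⟩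
  have A1 := And.intro a1 e1
  have A2 := And.intro a2 (Eq.refl (∫ z : Example d, ind 1 z * inner ℝ w z.1 ^ 2 ∂ρ))
  have B0 : Integrable (ind (-1)) ρ ∧ ∫ z, ind (-1) z ∂ρ = 1 - p := ⟨b0, f0⟩
  have B1 := And.intro b1 f1
  have B2 := And.intro b2 (Eq.refl (∫ z : Example d, ind (-1) z * inner ℝ w z.1 ^ 2 ∂ρ))
  have C (c : ℝ) : Integrable (fun _ : Example d => c) ρ ∧ ∫ _ : Example d, c ∂ρ = c :=
    ⟨integrable_const c, by simp⟩
  have key := integrable_and_integral_add (integrable_and_integral_add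
    (integrable_and_integral_add (integrable_and_integral_add (integrable_and_integral_add
    (integrable_and_integral_add (integrable_and_integral_const_mul (1 - p) A2)
      (integrable_and_integral_const_mul (-2 * (1 - p) * U) A1))
      (integrable_and_integral_const_mul ((1 - p) * U ^ 2) A0))
      (integrable_and_integral_const_mul p B2))
      (integrable_and_integral_const_mul (-2 * p * V) B1))
      (integrable_and_integral_const_mul (p * V ^ 2) B0))
      (C (2 * p * (1 - p) * (V - U) + p * (1 - p) * (V - U) ^ 2 + p * (1 - p)))
  -- The six terms of `(1 - a + b) ^ 2`, each a product of a function of one example and a function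
  -- of the other.
  have key2 := integrable_and_integral_add (integrable_and_integral_add
    (integrable_and_integral_add (integrable_and_integral_add (integrable_and_integral_add
      (integrable_and_integral_mul_prod A0 B0) (integrable_and_integral_mul_prod A2 B0))
      (integrable_and_integral_mul_prod A0 B2))
      (integrable_and_integral_const_mul (-2) (integrable_and_integral_mul_prod A1 B0)))
      (integrable_and_integral_const_mul 2 (integrable_and_integral_mul_prod A0 B1)))
      (integrable_and_integral_const_mul (-2) (integrable_and_integral_mul_prod A1 B1))
  refine ⟨hloss ▸ key.1, ?_⟩
  rw [hloss, key.2, risk_eq_integral_prod hl hp]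
  refine Eq.trans (integral_congr_ae (ae_of_all _ fun q => ?_)) (key2.2.trans ?_)
  · simp only [inner_sub_right]
    ring
  · ring

/-- The loss is quadratic in `w`. -/
theorem lossHat_add (p : ℝ) (u v w h : E d) (z : Example d) :
    lossHat p u v (w + h) z = lossHat p u v w z + inner ℝ h (gradHat p u v w z)
      + 1 / 2 * inner ℝ h (gradHat p u v h z - gradHat p u v 0 z) := by
  simp only [lossHat, gradHat, inner_add_left, inner_add_right, inner_sub_right (𝕜 := ℝ) h (_ + _ + _ + _),
    real_inner_smul_right, inner_zero_left]
  ring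

theorem GoodLaw.classProb_neg_one_pos (h : GoodLaw ρ κ) : 0 < classProb ρ (-1) := by
  rw [classProb_neg_one h.label]; linarith [h.lt_one]

theorem GoodLaw.norm_gradPop_le (h : GoodLaw ρ κ) (w : E d) {z : Example d} (hz : ‖z.1‖ ≤ κ) :
    ‖gradPop ρ w z‖ ≤ 24 * κ ^ 2 * (1 + ‖w‖) :=
  norm_gradHat_le h.one_le h.pos.le h.lt_one.le (norm_classMean_le h.bound h.classProb_one_pos)
    (norm_classMean_le h.bound h.classProb_neg_one_pos) hz

theorem GoodLaw.integrable_gradPop (h : GoodLaw ρ κ) (w : E d) : Integrable (gradPop ρ w) ρ :=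
  Integrable.of_bound (measurable_gradPop w).aestronglyMeasurable _
    (h.bound.mono fun _ hz => h.norm_gradPop_le w hz)

theorem GoodLaw.norm_riskGrad_le (h : GoodLaw ρ κ) (w : E d) :
    ‖riskGrad ρ w‖ ≤ 24 * κ ^ 2 * (1 + ‖w‖) := by
  simpa [riskGrad] using norm_integral_le_of_norm_le_const (h.bound.mono fun _ hz => h.norm_gradPop_le w hz)

theorem GoodLaw.integrable_gradPop_sub (h : GoodLaw ρ κ) (w : E d) :
    Integrable (fun z => gradPop ρ w z - gradPop ρ 0 z) ρ :=
  (h.integrable_gradPop w).sub (h.integrable_gradPop 0)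

/-- Half the Hessian of the risk. -/
def hess (h : GoodLaw ρ κ) : E d →ₗ[ℝ] E d where
  toFun w := (1 / 2 : ℝ) • ∫ z, (gradPop ρ w z - gradPop ρ 0 z) ∂ρ
  map_add' a b := by
    rw [← smul_add, ← integral_add (h.integrable_gradPop_sub a) (h.integrable_gradPop_sub b)]
    congr 2
    funext z
    simp only [gradPop, gradHat, inner_add_left, inner_zero_left]
    module
  map_smul' c a := by
    rw [RingHom.id_apply, smul_comm c, ← integral_smul c]
    congr 2
    funext z
    simp only [gradPop, gradHat, real_inner_smul_left, inner_zero_left]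
    module

theorem inner_hess (h : GoodLaw ρ κ) (a b : E d) :
    inner ℝ a (hess h b) = 1 / 2 * ∫ z, inner ℝ a (gradPop ρ b z - gradPop ρ 0 z) ∂ρ := by
  rw [integral_inner (h.integrable_gradPop_sub b),
    ← real_inner_smul_right]
  rfl

theorem hess_isSymmetric (h : GoodLaw ρ κ) : (hess h).IsSymmetric := by
  intro a b
  rw [real_inner_comm, inner_hess, inner_hess]
  congr 2
  funext z
  simp only [gradPop, gradHat, inner_sub_right _ (_ + _ + _ + _), inner_add_right,
    real_inner_smul_right, inner_zero_left]
  ring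

theorem inner_hess_nonneg (h : GoodLaw ρ κ) (a : E d) : 0 ≤ inner ℝ a (hess h a) := by
  rw [inner_hess]
  refine mul_nonneg (by norm_num) (integral_nonneg fun z => ?_)
  have e : inner ℝ a (gradPop ρ a z - gradPop ρ 0 z)
      = 2 * ((1 - posProb ρ) * ind 1 z * inner ℝ a (z.1 - classMean ρ 1) ^ 2
        + posProb ρ * ind (-1) z * inner ℝ a (z.1 - classMean ρ (-1)) ^ 2
        + posProb ρ * (1 - posProb ρ) * inner ℝ a (classMean ρ (-1) - classMean ρ 1) ^ 2) := by
    simp only [gradPop, gradHat, inner_sub_right _ (_ + _ + _ + _), inner_add_right,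
      real_inner_smul_right, inner_zero_left]
    ring
  have h1 := ind_nonneg 1 z
  have h2 := ind_nonneg (-1) z
  have h3 := h.pos
  have h4 : 0 < 1 - posProb ρ := by linarith [h.lt_one]
  rw [Pi.zero_apply, e]
  positivity

/-- The risk is a quadratic function with gradient `riskGrad`. -/
theorem risk_add (h : GoodLaw ρ κ) (w a : E d) :
    risk ρ (w + a) = risk ρ w + inner ℝ a (riskGrad ρ w) + inner ℝ a (hess h a) := by
  have hw := risk_eq_integral_lossPop h.bound h.label ⟨h.pos, h.lt_one⟩ w
  have hwa := risk_eq_integral_lossPop h.bound h.label ⟨h.pos, h.lt_one⟩ (w + a)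
  have h1 := (h.integrable_gradPop w).const_inner (𝕜 := ℝ) a
  have h2 := (h.integrable_gradPop_sub a).const_inner (𝕜 := ℝ) a
  have key := integrable_and_integral_add (integrable_and_integral_add ⟨hw.1, hw.2.symm⟩
    ⟨h1, integral_inner (h.integrable_gradPop w) a⟩)
    (integrable_and_integral_const_mul (1 / 2) ⟨h2, rfl⟩)
  rw [hwa.2, inner_hess]
  refine Eq.trans (integral_congr_ae (ae_of_all _ fun z => ?_)) key.2
  exact lossHat_add _ _ _ _ _ _

theorem risk_ge_linear (h : GoodLaw ρ κ) (w v : E d) :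
    risk ρ w + inner ℝ (v - w) (riskGrad ρ w) ≤ risk ρ v := by
  have := risk_add h w (v - w)
  rw [add_sub_cancel] at this
  linarith [inner_hess_nonneg h (v - w)]

theorem exists_risk_center (h : GoodLaw ρ κ) :
    ∃ w₀, ∀ w, risk ρ w = risk ρ w₀ + inner ℝ (w - w₀) (hess h (w - w₀)) := by
  refine exists_quadratic_center (hess_isSymmetric h) (b := riskGrad ρ 0) (c := risk ρ 0)
    (fun w => ?_) (risk_nonneg h)
  rw [← risk_add h 0 w, zero_add]

/-! ### The pathwise recursion -/

/-- One step of the method, with weight `a` and step size `2 / (σ (a + 1))`. -/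
theorem weighted_step_le {σ a Δ : ℝ} (hσ : 0 < σ) (ha : 0 < a) {w s ĝ g r : E d}
    (hΔ : Δ ≤ inner ℝ (w - s) r) (hgrow : σ * ‖w - s‖ ^ 2 ≤ Δ) :
    (a + 1) * a * ‖w - (2 / (σ * (a + 1))) • ĝ - s‖ ^ 2
      ≤ a * (a - 1) * ‖w - s‖ ^ 2 + (-(1 / σ * (a * Δ)) + 4 / σ ^ 2 * (a * ‖ĝ - g‖ ^ 2)
        + 4 / σ ^ 2 * ‖ĝ‖ ^ 2 - 4 / σ * (a * inner ℝ (w - s) (g - r))) := by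
  set η := 2 / (σ * (a + 1)) with hη
  have e1 : (a + 1) * η = 2 / σ := by rw [hη]; field_simp
  rw [sub_right_comm, norm_sub_sq_real, norm_smul, mul_pow, Real.norm_eq_abs, sq_abs,
    inner_smul_right]
  have e2 : inner ℝ (w - s) ĝ = inner ℝ (w - s) r + inner ℝ (w - s) (g - r)
      + inner ℝ (w - s) (ĝ - g) := by
    rw [← inner_add_right, ← inner_add_right]; congr 1; abel
  have e3 : -(σ / 4 * ‖w - s‖ ^ 2 + 1 / σ * ‖ĝ - g‖ ^ 2) ≤ inner ℝ (w - s) (ĝ - g) := by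
    have h1 := (abs_le.1 (abs_real_inner_le_norm (w - s) (ĝ - g))).1
    have h2 : ‖w - s‖ * ‖ĝ - g‖ ≤ σ / 4 * ‖w - s‖ ^ 2 + 1 / σ * ‖ĝ - g‖ ^ 2 := by
      have h3 : 0 ≤ 1 / σ * (σ / 2 * ‖w - s‖ - ‖ĝ - g‖) ^ 2 := by positivity
      have h4 : 1 / σ * (σ / 2 * ‖w - s‖ - ‖ĝ - g‖) ^ 2
          = σ / 4 * ‖w - s‖ ^ 2 + 1 / σ * ‖ĝ - g‖ ^ 2 - ‖w - s‖ * ‖ĝ - g‖ := by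
        field_simp
        ring
      linarith
    linarith
  have e4 : (a + 1) * a * (η ^ 2 * ‖ĝ‖ ^ 2) ≤ 4 / σ ^ 2 * ‖ĝ‖ ^ 2 := by
    have h1 : (a + 1) * a * η ^ 2 ≤ 4 / σ ^ 2 := by
      calc (a + 1) * a * η ^ 2 ≤ (a + 1) * (a + 1) * η ^ 2 := by gcongr; linarith
        _ = ((a + 1) * η) ^ 2 := by ring
        _ = 4 / σ ^ 2 := by rw [e1, div_pow]; norm_num
    calc _ = (a + 1) * a * η ^ 2 * ‖ĝ‖ ^ 2 := by ring
      _ ≤ _ := by gcongr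
  -- The bias costs a quarter of `Δ` by Young's inequality and growth. After scaling, `3 * a * Δ /
  -- σ` is available; `2 * a * Δ / σ` of it pays for lowering the weight `(a + 1) * a` to `a * (a -
  -- 1)`.
  have e5 : 3 / 4 * Δ - 1 / σ * ‖ĝ - g‖ ^ 2 + inner ℝ (w - s) (g - r) ≤ inner ℝ (w - s) ĝ := by
    rw [e2]; linarith
  have e6 := mul_le_mul_of_nonneg_left e5 (show 0 ≤ 4 / σ * a by positivity)
  have e7 : (a + 1) * a * (2 * (η * inner ℝ (w - s) ĝ)) = 4 / σ * a * inner ℝ (w - s) ĝ := by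
    calc _ = 2 * a * ((a + 1) * η) * inner ℝ (w - s) ĝ := by ring
      _ = _ := by rw [e1]; ring
  have e8 : 2 * a * ‖w - s‖ ^ 2 ≤ 2 * (1 / σ * (a * Δ)) := by
    have := mul_le_mul_of_nonneg_left hgrow (show 0 ≤ 2 / σ * a by positivity)
    calc 2 * a * ‖w - s‖ ^ 2 = 2 / σ * a * (σ * ‖w - s‖ ^ 2) := by field_simp
      _ ≤ _ := this
      _ = _ := by ring
  have e9 : 4 / σ * a * (3 / 4 * Δ - 1 / σ * ‖ĝ - g‖ ^ 2 + inner ℝ (w - s) (g - r))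
      = 3 * (1 / σ * (a * Δ)) - 4 / σ ^ 2 * (a * ‖ĝ - g‖ ^ 2)
        + 4 / σ * (a * inner ℝ (w - s) (g - r)) := by
    field_simp
  rw [e9] at e6
  rw [mul_add, mul_sub, e7]
  linarith

/-- With `a = k + t₁ + 1`, the weight `a * (a - 1)` on the right at time `k` is the left weight at
time `k - 1`. -/
theorem weighted_telescope {t₁ : ℝ} {D R : ℕ → ℝ} {T : ℕ}
    (h : ∀ k, 1 ≤ k → k ≤ T → ((k : ℝ) + t₁ + 1 + 1) * (k + t₁ + 1) * D (k + 1)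
      ≤ (k + t₁ + 1) * (k + t₁ + 1 - 1) * D k + R k) (t : ℕ) (ht : t ≤ T) :
    ((t : ℝ) + t₁ + 1 + 1) * (t + t₁ + 1) * D (t + 1)
      ≤ (t₁ + 2) * (t₁ + 1) * D 1 + ∑ k ∈ Finset.Ico 1 (t + 1), R k := by
  induction t with
  | zero =>
    refine le_of_eq ?_
    simp only [Nat.cast_zero, zero_add, Finset.Ico_self, Finset.sum_empty]
    ring
  | succ t ih =>
    have h1 := h (t + 1) (by omega) ht
    have h2 := ih (by omega)
    rw [Finset.sum_Ico_succ_top (by omega)]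
    push_cast at h1 ⊢
    have e : ((t : ℝ) + 1 + t₁ + 1) * (t + 1 + t₁ + 1 - 1) * D (t + 1)
        = (t + t₁ + 1 + 1) * (t + t₁ + 1) * D (t + 1) := by ring
    linarith

theorem sum_inv_le_one_add_log (t : ℕ) (ht : 1 ≤ t) :
    ∑ k ∈ Finset.Ico 1 (t + 1), 1 / (k : ℝ) ≤ 1 + Real.log t := by
  induction t, ht using Nat.le_induction with
  | base => simp
  | succ t ht ih =>
    rw [Finset.sum_Ico_succ_top (by omega)]
    have := inv_succ_le_log t ht
    push_cast
    linarith

theorem half_mul_le_sum_weights {t₁ : ℝ} (h : 0 ≤ t₁) (t : ℕ) :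
    (t : ℝ) * (t + t₁ + 1) / 2 ≤ ∑ k ∈ Finset.Ico 1 (t + 1), ((k : ℝ) + t₁ + 1) := by
  induction t with
  | zero => simp
  | succ t ih =>
    rw [Finset.sum_Ico_succ_top (by omega)]
    push_cast
    nlinarith [Nat.cast_nonneg (α := ℝ) t]

variable {ρ : Measure (Example d)} [IsProbabilityMeasure ρ] {κ : ℝ}

/-- The martingale difference at the point `w`: the noise of the gradient in the direction of the
solution set. -/
def noise (h : GoodLaw ρ κ) (w₀ w : E d) (z : Example d) : ℝ :=
  inner ℝ (w - projKer (hess h) w₀ w) (gradPop ρ w z - riskGrad ρ w)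

/-- A bound for `noise`. -/
def noiseBound (h : GoodLaw ρ κ) (w₀ w : E d) : ℝ :=
  48 * κ ^ 2 * (1 + ‖w‖) * ‖w - projKer (hess h) w₀ w‖

theorem abs_noise_le (h : GoodLaw ρ κ) (w₀ w : E d) {z : Example d} (hz : ‖z.1‖ ≤ κ) :
    |noise h w₀ w z| ≤ noiseBound h w₀ w := by
  refine (abs_real_inner_le_norm _ _).trans ?_
  have h1 : ‖gradPop ρ w z - riskGrad ρ w‖ ≤ 48 * κ ^ 2 * (1 + ‖w‖) :=
    (norm_sub_le _ _).trans (by linarith [h.norm_gradPop_le w hz, h.norm_riskGrad_le w])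
  rw [noiseBound, mul_comm]
  exact mul_le_mul_of_nonneg_right h1 (norm_nonneg _)

theorem integral_noise (h : GoodLaw ρ κ) (w₀ w : E d) : ∫ z, noise h w₀ w z ∂ρ = 0 := by
  unfold noise
  have hi : Integrable (fun z => gradPop ρ w z - riskGrad ρ w) ρ :=
    (h.integrable_gradPop w).sub (integrable_const _)
  rw [integral_inner hi, integral_sub (h.integrable_gradPop w) (integrable_const _)]
  simp [riskGrad]

theorem continuous_riskGrad (h : GoodLaw ρ κ) : Continuous (riskGrad ρ) := by
  have e : riskGrad ρ = fun w => (2 : ℝ) • hess h w + riskGrad ρ 0 := by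
    funext w
    have h1 : hess h w = (1 / 2 : ℝ) • (riskGrad ρ w - riskGrad ρ 0) := by
      rw [riskGrad, riskGrad, ← integral_sub (h.integrable_gradPop w) (h.integrable_gradPop 0)]
      rfl
    rw [h1]
    module
  have hc : Continuous (hess h) := (hess h).continuous_of_finiteDimensional
  rw [e]
  fun_prop

theorem measurable_noise_comp (h : GoodLaw ρ κ) (w₀ : E d) {α : Type*} [MeasurableSpace α]
    {w : α → E d} {z : α → Example d} (hw : Measurable w) (hz : Measurable z) :
    Measurable fun a => noise h w₀ (w a) (z a) := by
  have h1 := (continuous_projKer (hess h) w₀).measurable.comp hw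
  have h2 := (continuous_riskGrad h).measurable.comp hw
  have h3 : Measurable fun a => gradPop ρ (w a) (z a) :=
    measurable_gradHat measurable_const measurable_const measurable_const hw hz
  exact (hw.sub h1).inner (h3.sub h2)

theorem measurable_noiseBound_comp (h : GoodLaw ρ κ) (w₀ : E d) {α : Type*} [MeasurableSpace α]
    {w : α → E d} (hw : Measurable w) : Measurable fun a => noiseBound h w₀ (w a) := by
  have h1 := (continuous_projKer (hess h) w₀).measurable.comp hw
  exact ((hw.norm.const_add 1).const_mul _).mul (hw.sub h1).norm

/-- Jensen's inequality for the risk. -/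
theorem risk_wAvg_sub_le (h : GoodLaw ρ κ) {t₁ m : ℝ} (ht₁ : 0 ≤ t₁) (w : ℕ → E d) (t : ℕ)
    (ht : 1 ≤ t) :
    (∑ k ∈ Finset.Ico 1 (t + 1), ((k : ℝ) + t₁ + 1)) * (risk ρ (wAvg t₁ w t) - m)
      ≤ ∑ k ∈ Finset.Ico 1 (t + 1), ((k : ℝ) + t₁ + 1) * (risk ρ (w k) - m) := by
  have hI : Finset.Icc 1 t = Finset.Ico 1 (t + 1) := by ext; simp
  set W := ∑ k ∈ Finset.Ico 1 (t + 1), ((k : ℝ) + t₁ + 1) with hW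
  have hWpos : 0 < W := by
    have h1 : (1 : ℝ) ≤ t := by exact_mod_cast ht
    have := half_mul_le_sum_weights ht₁ t
    have h2 : 0 < (t : ℝ) * (t + t₁ + 1) / 2 := by positivity
    linarith
  set b := wAvg t₁ w t with hb
  have hbs : W • b = ∑ k ∈ Finset.Ico 1 (t + 1), ((k : ℝ) + t₁ + 1) • w k := by
    rw [hb, wAvg, hI, smul_inv_smul₀ hWpos.ne']
  -- The linear terms of the tangents at the average cancel, so convexity at `b` can be summed.
  have hsum : ∑ k ∈ Finset.Ico 1 (t + 1), ((k : ℝ) + t₁ + 1) * inner ℝ (w k - b) (riskGrad ρ b)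
      = 0 := by
    simp only [← real_inner_smul_left]
    rw [← sum_inner]
    simp only [smul_sub]
    rw [Finset.sum_sub_distrib, ← Finset.sum_smul, ← hbs, sub_self, inner_zero_left]
  rw [← add_zero (W * _), ← hsum, hW, Finset.sum_mul, ← Finset.sum_add_distrib]
  refine Finset.sum_le_sum fun k _ => ?_
  rw [← mul_add]
  refine mul_le_mul_of_nonneg_left ?_ (by positivity)
  linarith [risk_ge_linear h b (w k)]

section Path

variable {ρ : Measure (Example d)} [IsProbabilityMeasure ρ] {κ : ℝ}

/-- The factor by which deviations of empirical frequencies and moments enter the gradient. -/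
def biasFactor (ρ : Measure (Example d)) (κ : ℝ) : ℝ :=
  32 * κ ^ 2 * (1 + ((classProb ρ 1)⁻¹ + (classProb ρ (-1))⁻¹) * (κ + 1))

/-- The gradient is Lipschitz in its parameters, and the empirical class means inherit the accuracy
of frequencies and moments up to the inverse class probability. -/
theorem norm_stochGrad_sub_le (h : GoodLaw ρ κ) {z : ℕ → Example d} (hz : ∀ i, ‖(z i).1‖ ≤ κ)
    {ε : ℝ} {t : ℕ} (hdev : ∀ c : ℝ, c = 1 ∨ c = -1 →
      |freqHat c z t - classProb ρ c| ≤ ε ∧ ‖momHat c z t - classMom ρ c‖ ≤ ε) (w : E d) :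
    ‖stochGrad z w t - gradPop ρ w (z t)‖ ≤ biasFactor ρ κ * (1 + ‖w‖) * ε := by
  have hk : 0 ≤ κ := by linarith [h.one_le]
  have h1 := h.classProb_one_pos
  have h2 := h.classProb_neg_one_pos
  have hmean : ∀ c : ℝ, c = 1 ∨ c = -1 → 0 < classProb ρ c →
      ‖meanHat c z t - classMean ρ c‖ ≤ (classProb ρ c)⁻¹ * ((κ + 1) * ε) := by
    intro c hc hpos
    refine (norm_meanHat_sub_le hk hz hpos (classProb_smul_classMean hpos.ne') t).trans ?_
    refine mul_le_mul_of_nonneg_left ?_ (inv_pos.2 hpos).le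
    have := mul_le_mul_of_nonneg_left (hdev c hc).1 hk
    linarith [(hdev c hc).2]
  have hp : |pHat z t - posProb ρ| ≤ ε := by
    rw [← classProb_one]; exact (hdev 1 (Or.inl rfl)).1
  refine (norm_gradHat_sub_le h.one_le (pHat_nonneg z t) (pHat_le_one z t) h.pos.le h.lt_one.le
    (norm_meanHat_le hk hz t) (norm_meanHat_le hk hz t) (norm_classMean_le h.bound h1)
    (norm_classMean_le h.bound h2) (hz t)).trans ?_
  have hs : |pHat z t - posProb ρ| + ‖meanHat 1 z t - classMean ρ 1‖
      + ‖meanHat (-1) z t - classMean ρ (-1)‖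
      ≤ (1 + ((classProb ρ 1)⁻¹ + (classProb ρ (-1))⁻¹) * (κ + 1)) * ε := by
    linarith [hmean 1 (Or.inl rfl) h1, hmean (-1) (Or.inr rfl) h2]
  refine (mul_le_mul_of_nonneg_left hs (by positivity)).trans (le_of_eq ?_)
  rw [biasFactor]
  ring

/-- The constant in the bound `(1 + ‖w_t‖)² ≤ sizeConst σ * Λ`. -/
def sizeConst (σ : ℝ) : ℝ := 2 * (1 + 4 / σ)

theorem one_add_norm_sq_le {σ Λ : ℝ} (hσ : 0 < σ) (hΛ : 1 ≤ Λ) {w : E d}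
    (hw : ‖w‖ ^ 2 ≤ 4 / σ * Λ) : (1 + ‖w‖) ^ 2 ≤ sizeConst σ * Λ := by
  rw [sizeConst]
  have : 0 < 4 / σ := by positivity
  nlinarith [sq_nonneg (1 - ‖w‖)]

/-- The scale of the quadratic variation of the noise. -/
def varConst (κ σ : ℝ) : ℝ := (48 * κ ^ 2) ^ 2 * sizeConst σ

/-- The exponent used in the deviation inequality for the noise up to time `t`. -/
def tilt (κ σ t₁ Λ : ℝ) (t : ℕ) : ℝ := σ / (4 * (varConst κ σ * Λ) * (t + t₁ + 1))

/-- The constant of the pathwise bound. -/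
def rateConst (h : GoodLaw ρ κ) (w₀ : E d) (σ K ℓ : ℝ) : ℝ :=
  2 * ‖projKer (hess h) w₀ 0‖ ^ 2 + 4 / σ ^ 2 * (2 * (biasFactor ρ κ ^ 2 * sizeConst σ * K ^ 2)
    + (24 * κ ^ 2) ^ 2 * sizeConst σ + 4 * varConst κ σ * ℓ)

/-- The tilt is chosen so that growth turns each squared noise bound into at most `tilt / 4` times
the weighted excess risk. Dividing by the tilt leaves an eighth of the excess sum plus `L / tilt`,
which is linear in `t + t₁ + 1`. -/
theorem sum_noise_le (h : GoodLaw ρ κ) {w₀ : E d} {σ t₁ Λ L : ℝ} (hσ : 0 < σ) (ht₁ : 0 ≤ t₁)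
    (hΛ : 1 ≤ Λ) {w : ℕ → E d} {z : ℕ → Example d} {Δ : ℕ → ℝ} {t : ℕ}
    (hw : ∀ k, 1 ≤ k → k ≤ t → ‖w k‖ ^ 2 ≤ 4 / σ * Λ)
    (hΔ : ∀ k, σ * ‖w k - projKer (hess h) w₀ (w k)‖ ^ 2 ≤ Δ k)
    (hmart : ∑ k ∈ Finset.Ico 1 (t + 1), -(tilt κ σ t₁ Λ t * (k + t₁ + 1)) * noise h w₀ (w k) (z k)
      ≤ (∑ k ∈ Finset.Ico 1 (t + 1),
          (tilt κ σ t₁ Λ t * (k + t₁ + 1) * noiseBound h w₀ (w k)) ^ 2) / 2 + L) :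
    4 / σ * (-∑ k ∈ Finset.Ico 1 (t + 1), ((k : ℝ) + t₁ + 1) * noise h w₀ (w k) (z k))
      ≤ 1 / (2 * σ) * ∑ k ∈ Finset.Ico 1 (t + 1), ((k : ℝ) + t₁ + 1) * Δ k
        + 16 * varConst κ σ / σ ^ 2 * (Λ * L) * (t + t₁ + 1) := by
  have hk : 1 ≤ κ := h.one_le
  have hH : 0 < varConst κ σ := by unfold varConst sizeConst; positivity
  have hΛ0 : 0 < Λ := by linarith
  set a : ℝ := (t : ℝ) + t₁ + 1 with ha
  have ha0 : 0 < a := by positivity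
  set l := tilt κ σ t₁ Λ t with hl
  have hl0 : 0 < l := by rw [hl, tilt]; positivity
  have hla : l * (4 * (varConst κ σ * Λ) * a) = σ := by
    rw [hl, tilt, ← ha]; field_simp
  have hterm : ∀ k ∈ Finset.Ico 1 (t + 1), (l * ((k : ℝ) + t₁ + 1) * noiseBound h w₀ (w k)) ^ 2
      ≤ l / 4 * (((k : ℝ) + t₁ + 1) * Δ k) := by
    intro k hk'
    rw [Finset.mem_Ico] at hk'
    have hka : (k : ℝ) + t₁ + 1 ≤ a := by
      have : (k : ℝ) ≤ t := by exact_mod_cast Nat.lt_succ_iff.1 hk'.2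
      linarith
    have hk0 : 0 ≤ (k : ℝ) + t₁ + 1 := by positivity
    have h1 := one_add_norm_sq_le hσ hΛ (hw k hk'.1 (Nat.lt_succ_iff.1 hk'.2))
    have hS : 0 ≤ ‖w k - projKer (hess h) w₀ (w k)‖ ^ 2 := sq_nonneg _
    calc (l * ((k : ℝ) + t₁ + 1) * noiseBound h w₀ (w k)) ^ 2
        = l ^ 2 * ((k : ℝ) + t₁ + 1) * ((k : ℝ) + t₁ + 1) * ((48 * κ ^ 2) ^ 2 * (1 + ‖w k‖) ^ 2)
          * ‖w k - projKer (hess h) w₀ (w k)‖ ^ 2 := by rw [noiseBound]; ring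
      _ ≤ l ^ 2 * ((k : ℝ) + t₁ + 1) * a * ((48 * κ ^ 2) ^ 2 * (sizeConst σ * Λ))
          * ‖w k - projKer (hess h) w₀ (w k)‖ ^ 2 := by gcongr
      _ = l / 4 * ((k : ℝ) + t₁ + 1) * ((l * (4 * (varConst κ σ * Λ) * a))
          * ‖w k - projKer (hess h) w₀ (w k)‖ ^ 2) := by rw [varConst]; ring
      _ = l / 4 * ((k : ℝ) + t₁ + 1) * (σ * ‖w k - projKer (hess h) w₀ (w k)‖ ^ 2) := by rw [hla]
      _ ≤ l / 4 * ((k : ℝ) + t₁ + 1) * Δ k := by gcongr; exact hΔ k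
      _ = _ := by ring
  have hsum := Finset.sum_le_sum hterm
  rw [← Finset.mul_sum] at hsum
  set X := ∑ k ∈ Finset.Ico 1 (t + 1), ((k : ℝ) + t₁ + 1) * noise h w₀ (w k) (z k) with hX
  set Y := ∑ k ∈ Finset.Ico 1 (t + 1), ((k : ℝ) + t₁ + 1) * Δ k with hY
  have e : ∑ k ∈ Finset.Ico 1 (t + 1), -(l * ((k : ℝ) + t₁ + 1)) * noise h w₀ (w k) (z k)
      = l * (-X) := by
    rw [hX, ← Finset.sum_neg_distrib, Finset.mul_sum]
    exact Finset.sum_congr rfl fun _ _ => by ring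
  rw [e] at hmart
  have h2 : l * (-X) ≤ l * (1 / 8 * Y + L / l) := by
    rw [mul_add, mul_div_cancel₀ _ hl0.ne']
    linarith
  have h3 := le_of_mul_le_mul_left h2 hl0
  have h4 : L / l = 4 * (varConst κ σ * Λ) * a * L / σ := by
    rw [div_eq_div_iff hl0.ne' hσ.ne']
    linear_combination (-L) * hla
  rw [h4] at h3
  refine (mul_le_mul_of_nonneg_left h3 (by positivity : 0 ≤ 4 / σ)).trans (le_of_eq ?_)
  field_simp
  ring

/-- The pathwise bound: it holds as soon as the empirical frequencies and moments are close to
their expectations and the accumulated noise is small. -/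
theorem pathwise_bound (h : GoodLaw ρ κ) {w₀ : E d}
    (hf : ∀ w, risk ρ w = risk ρ w₀ + inner ℝ (w - w₀) (hess h (w - w₀)))
    {σ : ℝ} (hσ : QuadraticGrowth (risk ρ) σ) {K ℓ Λ t₁ : ℝ} (hℓ : 0 ≤ ℓ)
    (hΛ : 1 ≤ Λ) (ht₁ : 0 ≤ t₁) (hκt : 48 * κ ^ 2 ≤ σ * t₁) {T : ℕ} (hT : Real.log T ≤ Λ)
    {z : ℕ → Example d} (hz : ∀ i, ‖(z i).1‖ ≤ κ)
    (hdev : ∀ t, 1 ≤ t → t ≤ T → ∀ c : ℝ, c = 1 ∨ c = -1 →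
      |freqHat c z t - classProb ρ c| ≤ K * Λ / √t ∧ ‖momHat c z t - classMom ρ c‖ ≤ K * Λ / √t)
    {w : ℕ → E d} (hw : ∀ t, w t = spaucSeq (stepSize σ σ t₁) z t)
    (hmart : ∀ t, 1 ≤ t → t ≤ T →
      ∑ k ∈ Finset.Ico 1 (t + 1), -(tilt κ σ t₁ Λ t * (k + t₁ + 1)) * noise h w₀ (w k) (z k)
        ≤ (∑ k ∈ Finset.Ico 1 (t + 1),
            (tilt κ σ t₁ Λ t * (k + t₁ + 1) * noiseBound h w₀ (w k)) ^ 2) / 2 + ℓ * Λ)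
    (t : ℕ) (ht : 1 ≤ t) (htT : t ≤ T) :
    ((t : ℝ) + t₁ + 1 + 1) * (t + t₁ + 1) * ‖w (t + 1) - projKer (hess h) w₀ (w (t + 1))‖ ^ 2
      + 1 / (2 * σ) * ∑ k ∈ Finset.Ico 1 (t + 1), ((k : ℝ) + t₁ + 1) * (risk ρ (w k) - risk ρ w₀)
      ≤ rateConst h w₀ σ K ℓ * Λ ^ 4 * (1 + t₁) * (t + t₁ + 1) := by
  have hA := hess_isSymmetric h
  have hA0 := inner_hess_nonneg h
  have hσ0 := hσ.1
  have hk : 1 ≤ κ := h.one_le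
  have hk0 : 0 ≤ κ := by linarith
  have hN : 0 < sizeConst σ := by unfold sizeConst; positivity
  have hH : 0 < varConst κ σ := by unfold varConst; positivity
  have hmin (v : E d) : risk ρ (projKer (hess h) w₀ v) = risk ρ w₀ := by
    have h1 := (mem_solSet_iff hA hA0 hf).1 (projKer_mem_solSet hA hA0 hf v)
    rw [LinearMap.mem_ker] at h1
    rw [hf, h1, inner_zero_right, add_zero]
  have hgrow (k : ℕ) : σ * ‖w k - projKer (hess h) w₀ (w k)‖ ^ 2 ≤ risk ρ (w k) - risk ρ w₀ := by
    rw [← hmin (w k)]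
    exact hσ.2 _ _ ((isProj_iff_eq_projKer hA hA0 hf).2 rfl)
  have hlogk (k : ℕ) (hk1 : 1 ≤ k) (hkT : k ≤ T) : Real.log k ≤ Λ :=
    (Real.log_le_log (by exact_mod_cast hk1) (by exact_mod_cast hkT)).trans hT
  have hsize (k : ℕ) (hk1 : 1 ≤ k) (hkT : k ≤ T) : ‖w k‖ ^ 2 ≤ 4 / σ * Λ := by
    rw [hw]
    exact (norm_spaucSeq_sq_le hk hσ0 hκt hz k hk1).trans
      (mul_le_mul_of_nonneg_left (hlogk k hk1 hkT) (by positivity))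
  have hstep (k : ℕ) (hk1 : 1 ≤ k) (hkT : k ≤ T) := by
    have hstepk := weighted_step_le (a := (k : ℝ) + t₁ + 1) (w := w k)
      (s := projKer (hess h) w₀ (w k)) (ĝ := stochGrad z (w k) k) (g := gradPop ρ (w k) (z k))
      (r := riskGrad ρ (w k)) hσ0 (by positivity) (by
        have := risk_ge_linear h (w k) (projKer (hess h) w₀ (w k))
        rw [hmin, ← neg_sub, inner_neg_left] at this
        linarith) (hgrow k)
    have e1 : w k - (2 / (σ * ((k : ℝ) + t₁ + 1 + 1))) • stochGrad z (w k) k = w (k + 1) := by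
      rw [hw (k + 1), spaucSeq, ← hw k, stepSize_eq]
      congr 4
      ring
    rw [e1] at hstepk
    -- The one-step inequality is relative to the old projection; the new one is at least as close.
    have e2 : ‖w (k + 1) - projKer (hess h) w₀ (w (k + 1))‖ ^ 2
        ≤ ‖w (k + 1) - projKer (hess h) w₀ (w k)‖ ^ 2 :=
      pow_le_pow_left₀ (norm_nonneg _) (((isProj_iff_eq_projKer hA hA0 hf).2 rfl).2 _
        (projKer_mem_solSet hA hA0 hf (w k))) 2
    have e3 := one_add_norm_sq_le hσ0 hΛ (hsize k hk1 hkT)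
    have hkpos : (0 : ℝ) < k := by exact_mod_cast hk1
    have e4 : ‖stochGrad z (w k) k - gradPop ρ (w k) (z k)‖ ^ 2
        ≤ biasFactor ρ κ ^ 2 * sizeConst σ * K ^ 2 * Λ ^ 3 * (1 / (k : ℝ)) := by
      have h1 := pow_le_pow_left₀ (norm_nonneg _)
        (norm_stochGrad_sub_le h hz (hdev k hk1 hkT) (w k)) 2
      calc _ ≤ (biasFactor ρ κ * (1 + ‖w k‖) * (K * Λ / √k)) ^ 2 := h1
        _ = biasFactor ρ κ ^ 2 * (1 + ‖w k‖) ^ 2 * (K ^ 2 * Λ ^ 2 / k) := by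
          rw [mul_pow, mul_pow, div_pow, Real.sq_sqrt hkpos.le, mul_pow]
        _ ≤ biasFactor ρ κ ^ 2 * (sizeConst σ * Λ) * (K ^ 2 * Λ ^ 2 / k) := by gcongr
        _ = _ := by ring
    have e5 : ‖stochGrad z (w k) k‖ ^ 2 ≤ (24 * κ ^ 2) ^ 2 * (sizeConst σ * Λ) := by
      have h1 := pow_le_pow_left₀ (norm_nonneg _) (norm_gradHat_le (w := w k) hk (pHat_nonneg z k)
        (pHat_le_one z k) (norm_meanHat_le (c := 1) hk0 hz k) (norm_meanHat_le (c := -1) hk0 hz k)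
        (hz k)) 2
      rw [mul_pow] at h1
      exact h1.trans (by gcongr)
    -- The weight over `k` is `1 + (t₁ + 1) / k`. Its harmonic part produces the factor `1 + t₁` and
    -- the fourth power of `Λ`: one comes from the iterate size, two from the squared deviation, one
    -- from this sum.
    have e6 : ((k : ℝ) + t₁ + 1) * ‖stochGrad z (w k) k - gradPop ρ (w k) (z k)‖ ^ 2
        ≤ biasFactor ρ κ ^ 2 * sizeConst σ * K ^ 2 * Λ ^ 3 * (1 + (t₁ + 1) * (1 / (k : ℝ))) := by
      refine (mul_le_mul_of_nonneg_left e4 (by positivity)).trans (le_of_eq ?_)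
      field_simp
      ring
    have e7 : ((k : ℝ) + t₁ + 1 + 1) * (k + t₁ + 1)
        * ‖w (k + 1) - projKer (hess h) w₀ (w (k + 1))‖ ^ 2
        ≤ (k + t₁ + 1) * (k + t₁ + 1 - 1) * ‖w k - projKer (hess h) w₀ (w k)‖ ^ 2
          + (-(1 / σ) * ((k + t₁ + 1) * (risk ρ (w k) - risk ρ w₀))
            + 4 / σ ^ 2 * (biasFactor ρ κ ^ 2 * sizeConst σ * K ^ 2 * Λ ^ 3)
              * (1 + (t₁ + 1) * (1 / (k : ℝ)))
            + 4 / σ ^ 2 * ((24 * κ ^ 2) ^ 2 * (sizeConst σ * Λ))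
            + (-(4 / σ)) * ((k + t₁ + 1) * noise h w₀ (w k) (z k))) := by
      refine (mul_le_mul_of_nonneg_left e2 (by positivity)).trans (hstepk.trans ?_)
      have f1 := mul_le_mul_of_nonneg_left e6 (show 0 ≤ 4 / σ ^ 2 by positivity)
      have f2 := mul_le_mul_of_nonneg_left e5 (show 0 ≤ 4 / σ ^ 2 by positivity)
      rw [noise]
      linarith
    exact e7
  have htel := weighted_telescope (D := fun k => ‖w k - projKer (hess h) w₀ (w k)‖ ^ 2) hstep t htT
  simp only [Finset.sum_add_distrib, ← Finset.mul_sum] at htel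
  have hnoise := sum_noise_le h hσ0 ht₁ hΛ (fun k hk1 hkt => hsize k hk1 (hkt.trans htT)) hgrow
    (hmart t ht htT)
  have hD1 : ‖w 1 - projKer (hess h) w₀ (w 1)‖ ^ 2 = ‖projKer (hess h) w₀ 0‖ ^ 2 := by
    rw [hw, spaucSeq_one, zero_sub, norm_neg]
  rw [hD1] at htel
  have hinv := sum_inv_le_one_add_log t ht
  have hlogt := hlogk t ht htT
  simp only [Finset.sum_const, Nat.card_Ico, add_tsub_cancel_right, nsmul_eq_mul, mul_one] at htel
  set Y := ∑ k ∈ Finset.Ico 1 (t + 1), ((k : ℝ) + t₁ + 1) * (risk ρ (w k) - risk ρ w₀)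
  set X := ∑ k ∈ Finset.Ico 1 (t + 1), ((k : ℝ) + t₁ + 1) * noise h w₀ (w k) (z k)
  set Z := ∑ k ∈ Finset.Ico 1 (t + 1), 1 / (k : ℝ)
  set a : ℝ := (t : ℝ) + t₁ + 1 with ha
  have ht0 : (0 : ℝ) ≤ t := Nat.cast_nonneg t
  have ht1 : (1 : ℝ) ≤ t := by exact_mod_cast ht
  have ha0 : 0 ≤ a := by positivity
  have hΛ0 : 0 ≤ Λ := by linarith
  have hΛ4 : 1 ≤ Λ ^ 4 := one_le_pow₀ hΛ
  set Bc := biasFactor ρ κ ^ 2 * sizeConst σ * K ^ 2 with hBc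
  have hBc0 : 0 ≤ Bc := by positivity
  have hσ2 : 0 ≤ 4 / σ ^ 2 := by positivity
  have g1 : (t : ℝ) + (t₁ + 1) * Z ≤ 2 * Λ * a := by
    have : (t₁ + 1) * Z ≤ (t₁ + 1) * (2 * Λ) := by gcongr; linarith
    have : (t : ℝ) ≤ t * (2 * Λ) := le_mul_of_one_le_right ht0 (by linarith)
    rw [ha]; linarith
  have g2 : 4 / σ ^ 2 * (Bc * Λ ^ 3) * (t + (t₁ + 1) * Z)
      ≤ 4 / σ ^ 2 * (2 * Bc) * (Λ ^ 4 * ((1 + t₁) * a)) := by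
    calc _ ≤ 4 / σ ^ 2 * (Bc * Λ ^ 3) * (2 * Λ * a) := by gcongr
      _ = 4 / σ ^ 2 * (2 * Bc) * (Λ ^ 4 * (1 * a)) := by ring
      _ ≤ _ := by gcongr; linarith
  have g3 : t * (4 / σ ^ 2 * ((24 * κ ^ 2) ^ 2 * (sizeConst σ * Λ)))
      ≤ 4 / σ ^ 2 * ((24 * κ ^ 2) ^ 2 * sizeConst σ) * (Λ ^ 4 * ((1 + t₁) * a)) := by
    have h1 : t * Λ ≤ Λ ^ 4 * ((1 + t₁) * a) := by
      calc t * Λ ≤ a * Λ ^ 4 := by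
            gcongr
            · linarith
            · exact le_self_pow₀ hΛ (by norm_num)
        _ = Λ ^ 4 * (1 * a) := by ring
        _ ≤ _ := by gcongr; linarith
    calc _ = 4 / σ ^ 2 * ((24 * κ ^ 2) ^ 2 * sizeConst σ) * (t * Λ) := by ring
      _ ≤ _ := by gcongr
  have g4 : 16 * varConst κ σ / σ ^ 2 * (Λ * (ℓ * Λ)) * a
      ≤ 4 / σ ^ 2 * (4 * varConst κ σ * ℓ) * (Λ ^ 4 * ((1 + t₁) * a)) := by
    calc _ = 4 / σ ^ 2 * (4 * varConst κ σ * ℓ) * (Λ ^ 2 * (1 * a)) := by ring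
      _ ≤ _ := by
        gcongr
        · norm_num
        · linarith
  have g5 : (t₁ + 2) * (t₁ + 1) * ‖projKer (hess h) w₀ 0‖ ^ 2
      ≤ 2 * ‖projKer (hess h) w₀ 0‖ ^ 2 * (Λ ^ 4 * ((1 + t₁) * a)) := by
    calc _ = 1 * ((1 + t₁) * (t₁ + 2)) * ‖projKer (hess h) w₀ 0‖ ^ 2 := by ring
      _ ≤ Λ ^ 4 * ((1 + t₁) * (2 * a)) * ‖projKer (hess h) w₀ 0‖ ^ 2 := by
        gcongr
        linarith
      _ = _ := by ring
  have e8 : 1 / (2 * σ) * Y = 1 / σ * Y - 1 / (2 * σ) * Y := by field_simp; ring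
  rw [rateConst, ← hBc, e8]
  linarith

end Path

/-! ### The high-probability event -/

section Event

variable {ρ : Measure (Example d)} {κ : ℝ}

/-- The indicator of the label `c` (for `none`) and the coordinates of `x 𝟙[y = c]`. -/
def statFun (c : ℝ) (o : Option (Fin d)) (z : Example d) : ℝ :=
  o.elim (ind c z) fun j => (ind c z • z.1) j

theorem measurable_statFun (c : ℝ) (o : Option (Fin d)) : Measurable (statFun c o) := by
  cases o with
  | none => exact measurable_ind c
  | some j =>
    exact (EuclideanSpace.proj (𝕜 := ℝ) j).continuous.measurable.comp (measurable_ind_smul c)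

theorem abs_statFun_le (hκ : 1 ≤ κ) (c : ℝ) (o : Option (Fin d)) {z : Example d}
    (hz : ‖z.1‖ ≤ κ) : |statFun c o z| ≤ κ := by
  cases o with
  | none => exact (abs_ind_le_one c z).trans hκ
  | some j =>
    have h1 : ‖(ind c z • z.1) j‖ ≤ ‖ind c z • z.1‖ := PiLp.norm_apply_le _ j
    have h2 := norm_ind_smul_le c hz
    have h3 := mul_le_of_le_one_left (by linarith : 0 ≤ κ) (ind_le_one c z)
    exact h1.trans (h2.trans h3)

theorem norm_le_card_mul {x : E d} {b : ℝ} (h : ∀ j, |x j| ≤ b) : ‖x‖ ≤ d * b := by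
  rw [← (EuclideanSpace.basisFun (Fin d) ℝ).sum_repr x]
  refine (norm_sum_le _ _).trans ?_
  calc _ ≤ ∑ _j : Fin d, b := Finset.sum_le_sum fun j _ => by
        rw [norm_smul, OrthonormalBasis.norm_eq_one, mul_one]
        exact h j
    _ = d * b := by simp

/-- Frequency and moment coordinates are averages of `statFun`. Summing `d` coordinate bounds
controls the vector, and `d + 1` serves both conclusions. -/
theorem freqHat_momHat_close [IsProbabilityMeasure ρ] (h : GoodLaw ρ κ) {c B : ℝ}
    {z : ℕ → Example d} {t : ℕ} (ht : 1 ≤ t)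
    (hB : ∀ o, |∑ i ∈ Finset.range t, (statFun c o (z i) - ∫ b, statFun c o b ∂ρ)| ≤ √t * B) :
    |freqHat c z t - classProb ρ c| ≤ (d + 1) * B / √t ∧
      ‖momHat c z t - classMom ρ c‖ ≤ (d + 1) * B / √t := by
  have ht0 : (0 : ℝ) < t := by exact_mod_cast ht
  have hst : 0 < √(t : ℝ) := Real.sqrt_pos.2 ht0
  have hB0 : 0 ≤ B / √t := by
    refine div_nonneg ?_ hst.le
    exact nonneg_of_mul_nonneg_right ((abs_nonneg _).trans (hB none)) hst
  have hav (o : Option (Fin d)) :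
      |(t : ℝ)⁻¹ * ∑ i ∈ Finset.range t, statFun c o (z i) - ∫ b, statFun c o b ∂ρ| ≤ B / √t := by
    have h1 := hB o
    rw [Finset.sum_sub_distrib, Finset.sum_const, Finset.card_range, nsmul_eq_mul] at h1
    have h2 : (t : ℝ)⁻¹ * ∑ i ∈ Finset.range t, statFun c o (z i) - ∫ b, statFun c o b ∂ρ
        = (t : ℝ)⁻¹ * (∑ i ∈ Finset.range t, statFun c o (z i) - t * ∫ b, statFun c o b ∂ρ) := by
      field_simp
    rw [h2, abs_mul, abs_of_pos (inv_pos.2 ht0), inv_mul_le_iff₀ ht0]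
    refine h1.trans (le_of_eq ?_)
    rw [mul_div_assoc', eq_div_iff hst.ne', mul_right_comm, Real.mul_self_sqrt ht0.le]
  have e : (d + 1) * B / √t = d * (B / √t) + B / √t := by ring
  rw [e]
  constructor
  · have h1 := hav none
    have h2 : 0 ≤ d * (B / √t) := by positivity
    rw [freqHat, div_eq_inv_mul]
    exact h1.trans (by linarith)
  · refine (norm_le_card_mul fun j => ?_).trans (le_add_of_nonneg_right hB0)
    have h1 := hav (some j)
    have h2 : ∫ b, statFun c (some j) b ∂ρ = classMom ρ c j :=
      (EuclideanSpace.proj (𝕜 := ℝ) j).integral_comp_comm (integrable_ind_smul c h.bound)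
    rw [h2] at h1
    refine le_trans (le_of_eq ?_) h1
    simp [momHat, statFun]

/-- The number of events in the union bound per time step. -/
def eventCount (d : ℕ) : ℕ := Fintype.card (Bool × Option (Fin d) × Bool) + 1

/-- The inflation factor of the logarithmic term due to the union bound. -/
def logFactor (d : ℕ) : ℝ := Real.log (eventCount d) + 1

theorem logFactor_nonneg (d : ℕ) : 0 ≤ logFactor d := by
  have : 0 ≤ Real.log (eventCount d) := Real.log_natCast_nonneg _
  unfold logFactor
  linarith

theorem mul_exp_neg_logFactor_le {T : ℕ} {δ Λ : ℝ} (hT : 0 < T) (hδ : 0 < δ)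
    (hΛ : Λ = Real.log (T / δ)) (hΛ1 : 1 ≤ Λ) :
    (T : ℝ) * (eventCount d * Real.exp (-(logFactor d * Λ))) ≤ δ := by
  have hN : (0 : ℝ) < eventCount d := by unfold eventCount; positivity
  have hT' : (0 : ℝ) < T := by exact_mod_cast hT
  have h1 : -(logFactor d * Λ) ≤ -Real.log (eventCount d) - Λ := by
    have : 0 ≤ Real.log (eventCount d) := Real.log_natCast_nonneg _
    unfold logFactor
    nlinarith
  have h2 : Real.exp (-(logFactor d * Λ)) ≤ (eventCount d : ℝ)⁻¹ / (T / δ) := by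
    refine (Real.exp_le_exp.2 h1).trans (le_of_eq ?_)
    rw [Real.exp_sub, Real.exp_neg, Real.exp_log hN, hΛ, Real.exp_log (by positivity)]
  calc _ ≤ (T : ℝ) * (eventCount d * ((eventCount d : ℝ)⁻¹ / (T / δ))) := by gcongr
    _ = δ := by field_simp

variable [IsProbabilityMeasure ρ]

/-- A union bound over times, classes, statistics and signs, with one further event per time for the
accumulated noise. The factor `logFactor d` in the exponent pays for their number. -/
theorem measure_good_ge (h : GoodLaw ρ κ) (w₀ : E d) {σ t₁ : ℝ} (hσ : 0 < σ) (ht₁ : 0 ≤ t₁)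
    {T : ℕ} {δ Λ : ℝ} (hT : 0 < T) (hδ : 0 < δ) (hΛ : Λ = Real.log (T / δ)) (hΛ1 : 1 ≤ Λ)
    {S : Type*} [MeasurableSpace S] {μ : Measure S} [IsProbabilityMeasure μ]
    {z : ℕ → S → Example d} (hz : ∀ i, Measurable (z i)) (hind : ProbabilityTheory.iIndepFun z μ)
    (hlaw : ∀ i, μ.map (z i) = ρ) (η : ℕ → ℝ) :
    ENNReal.ofReal (1 - δ) ≤ μ {s | (∀ i, ‖(z i s).1‖ ≤ κ) ∧
      (∀ t, 1 ≤ t → t ≤ T → ∀ c : ℝ, c = 1 ∨ c = -1 →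
        |freqHat c (fun i => z i s) t - classProb ρ c|
            ≤ (d + 1) * (2 * κ ^ 2 + logFactor d) * Λ / √t ∧
          ‖momHat c (fun i => z i s) t - classMom ρ c‖
            ≤ (d + 1) * (2 * κ ^ 2 + logFactor d) * Λ / √t) ∧
      (∀ t, 1 ≤ t → t ≤ T → ∑ k ∈ Finset.Ico 1 (t + 1), -(tilt κ σ t₁ Λ t * (k + t₁ + 1))
          * noise h w₀ (spaucSeq η (fun i => z i s) k) (z k s)
        ≤ (∑ k ∈ Finset.Ico 1 (t + 1), (tilt κ σ t₁ Λ t * (k + t₁ + 1)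
            * noiseBound h w₀ (spaucSeq η (fun i => z i s) k)) ^ 2) / 2 + logFactor d * Λ)} := by
  set L := logFactor d * Λ with hL
  let lab : Bool → ℝ := fun b => if b then 1 else -1
  have hlab : ∀ b, |lab b| = 1 := by intro b; cases b <;> simp [lab]
  -- The last Boolean is a sign, so one-sided inequalities yield two-sided ones.
  let g : Bool × Option (Fin d) × Bool → Example d → ℝ :=
    fun q x => lab q.2.2 * statFun (lab q.1) q.2.1 x
  let Bd : ℕ → Bool × Option (Fin d) × Bool → Set S := fun t q =>
    {s | √t * (2 * κ ^ 2 + L) ≤ ∑ i ∈ Finset.range t, (g q (z i s) - ∫ b, g q b ∂ρ)}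
  let Bm : ℕ → Set S := fun t =>
    {s | (∑ k ∈ Finset.Ico 1 (t + 1), (tilt κ σ t₁ Λ t * (k + t₁ + 1)
            * noiseBound h w₀ (spaucSeq η (fun i => z i s) k)) ^ 2) / 2 + L
        ≤ ∑ k ∈ Finset.Ico 1 (t + 1), -(tilt κ σ t₁ Λ t * (k + t₁ + 1))
          * noise h w₀ (spaucSeq η (fun i => z i s) k) (z k s)}
  let N : Set S := {s | ¬ ∀ i, ‖(z i s).1‖ ≤ κ}
  let bad : Set S := N ∪ ⋃ t ∈ Finset.Icc 1 T, (Bm t ∪ ⋃ q, Bd t q)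
  have hgm (q) : Measurable (g q) := (measurable_statFun _ _).const_mul _
  have hgb (q) : ∀ᵐ b ∂ρ, |g q b| ≤ κ := h.bound.mono fun b hb => by
    rw [abs_mul, hlab, one_mul]
    exact abs_statFun_le h.one_le _ _ hb
  have hBd (t : ℕ) (ht : 1 ≤ t) (q) : μ (Bd t q) ≤ ENNReal.ofReal (Real.exp (-L)) :=
    measure_sum_sub_integral_ge_le hz hind hlaw (hgm q) (hgb q) ht L
  have hBm (t : ℕ) : μ (Bm t) ≤ ENNReal.ofReal (Real.exp (-L)) := by
    have hH : 0 < varConst κ σ := by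
      have := h.one_le
      unfold varConst sizeConst; positivity
    have htilt : 0 ≤ tilt κ σ t₁ Λ t := by unfold tilt; positivity
    refine measure_sum_ge_le hz hind hlaw
      (h := fun k a b => -(tilt κ σ t₁ Λ t * (k + t₁ + 1)) * noise h w₀ (spaucSeq η a k) b)
      (M := fun k a => tilt κ σ t₁ Λ t * (k + t₁ + 1) * noiseBound h w₀ (spaucSeq η a k))
      (fun k => ?_) (fun k => ?_) (fun k a a' haa => ?_) (fun k a => ?_) (fun k a => ?_) 1 (t + 1) L
    · exact (measurable_noise_comp h w₀ ((measurable_spaucSeq η k).comp measurable_fst)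
        measurable_snd).const_mul _
    · exact (measurable_noiseBound_comp h w₀ (measurable_spaucSeq η k)).const_mul _
    · simp only [spaucSeq_congr η k haa, and_self]
    · filter_upwards [h.bound] with b hb
      have hk : 0 ≤ tilt κ σ t₁ Λ t * (k + t₁ + 1) := by positivity
      rw [abs_mul, abs_neg, abs_of_nonneg hk]
      exact mul_le_mul_of_nonneg_left (abs_noise_le h w₀ _ hb) hk
    · rw [integral_const_mul, integral_noise, mul_zero]
  have hN : μ N = 0 := by
    have : ∀ᵐ s ∂μ, ∀ i, ‖(z i s).1‖ ≤ κ := ae_all_iff.2 fun i =>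
      ae_of_ae_map (hz i).aemeasurable (by rw [hlaw]; exact h.bound)
    exact this
  have hbad : μ bad ≤ ENNReal.ofReal δ := by
    calc μ bad ≤ μ N + μ (⋃ t ∈ Finset.Icc 1 T, (Bm t ∪ ⋃ q, Bd t q)) := measure_union_le _ _
      _ ≤ 0 + ∑ t ∈ Finset.Icc 1 T, μ (Bm t ∪ ⋃ q, Bd t q) :=
        add_le_add hN.le (measure_biUnion_finset_le _ _)
      _ ≤ 0 + ∑ _t ∈ Finset.Icc 1 T, (eventCount d : ENNReal) * ENNReal.ofReal (Real.exp (-L)) := by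
        refine add_le_add le_rfl (Finset.sum_le_sum fun t ht => ?_)
        refine (measure_union_le _ _).trans ((add_le_add (hBm t)
          ((measure_iUnion_fintype_le _ _).trans (Finset.sum_le_sum fun q _ =>
            hBd t (Finset.mem_Icc.1 ht).1 q))).trans (le_of_eq ?_))
        rw [Finset.sum_const, Finset.card_univ, nsmul_eq_mul, eventCount, Nat.cast_add, add_mul,
          Nat.cast_one, one_mul, add_comm]
      _ = ENNReal.ofReal ((T : ℝ) * (eventCount d * Real.exp (-L))) := by
        rw [zero_add, Finset.sum_const, Nat.card_Icc, Nat.add_sub_cancel, nsmul_eq_mul,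
          ENNReal.ofReal_mul (Nat.cast_nonneg _), ENNReal.ofReal_mul (Nat.cast_nonneg _),
          ENNReal.ofReal_natCast, ENNReal.ofReal_natCast]
      _ ≤ ENNReal.ofReal δ := ENNReal.ofReal_le_ofReal (mul_exp_neg_logFactor_le hT hδ hΛ hΛ1)
  -- Subadditivity alone suffices, so measurability of `bad` is not needed.
  have hcover : ENNReal.ofReal (1 - δ) ≤ μ badᶜ := by
    rw [ENNReal.ofReal_sub _ hδ.le, ENNReal.ofReal_one, tsub_le_iff_right,
      ← measure_univ (μ := μ), ← Set.compl_union_self bad]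
    exact (measure_union_le _ _).trans (add_le_add le_rfl hbad)
  refine hcover.trans (measure_mono fun s hs => ?_)
  have hs' : s ∉ bad := hs
  simp only [bad, Set.mem_union, Set.mem_iUnion, not_or, not_exists] at hs'
  obtain ⟨hsN, hsB⟩ := hs'
  have hsN : ∀ i, ‖(z i s).1‖ ≤ κ := not_not.1 hsN
  refine ⟨hsN, fun t ht1 htT c hc => ?_, fun t ht1 htT => ?_⟩
  · have hst := (hsB t (Finset.mem_Icc.2 ⟨ht1, htT⟩)).2
    have hgood (q) : ∑ i ∈ Finset.range t, (g q (z i s) - ∫ b, g q b ∂ρ) ≤ √t * (2 * κ ^ 2 + L) :=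
      (not_le.1 (hst q)).le
    have hlt : √(t : ℝ) * (2 * κ ^ 2 + L) ≤ √t * ((2 * κ ^ 2 + logFactor d) * Λ) := by
      refine mul_le_mul_of_nonneg_left ?_ (Real.sqrt_nonneg _)
      rw [hL]
      nlinarith [sq_nonneg κ]
    obtain ⟨b, rfl⟩ : ∃ b, lab b = c := by
      rcases hc with rfl | rfl
      · exact ⟨true, rfl⟩
      · exact ⟨false, rfl⟩
    have := freqHat_momHat_close (c := lab b) (z := fun i => z i s) h ht1 fun o => by
      have h1 := hgood (b, o, true)
      have h2 := hgood (b, o, false)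
      simp only [g, lab, if_true, one_mul, Bool.false_eq_true, if_false, integral_const_mul] at h1 h2
      rw [← Finset.sum_congr rfl fun i _ => mul_sub _ _ _, ← Finset.mul_sum] at h2
      refine (abs_le.2 ⟨?_, h1⟩).trans hlt
      linarith
    simpa only [mul_assoc] using this
  · exact (not_le.1 (hsB t (Finset.mem_Icc.2 ⟨ht1, htT⟩)).1).le

end Event

/-! ### The main result -/

theorem goodLaw_kappa {X : Set (E d)} (hX : Bornology.IsBounded X) {ρ : Measure (Example d)}
    (hsupp : ∀ᵐ z ∂ρ, z.1 ∈ X ∧ (z.2 = 1 ∨ z.2 = -1))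
    (hp : 0 < posProb ρ ∧ posProb ρ < 1) : GoodLaw ρ (kappa X) where
  one_le := le_max_left _ _
  bound := by
    have hb : BddAbove (Set.range fun x : X => ‖(x : E d)‖) := by
      obtain ⟨R, hR⟩ := hX.exists_norm_le
      exact ⟨R, by rintro _ ⟨x, rfl⟩; exact hR x x.2⟩
    exact hsupp.mono fun z hz => (le_ciSup hb ⟨z.1, hz.1⟩).trans (le_max_right _ _)
  label := hsupp.mono fun z hz => hz.2
  pos := hp.1
  lt_one := hp.2

theorem phi_zero (ρ : Measure (Example d)) : phi ρ (fun _ => 0) = risk ρ := by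
  funext w; simp [phi]

variable {ρ : Measure (Example d)} [IsProbabilityMeasure ρ] {κ : ℝ}

/-- The rates on a path on which the weighted bound of `pathwise_bound` holds. -/
theorem rates_of_weighted_bound (h : GoodLaw ρ κ) {w₀ : E d}
    (hmin : ∀ w, risk ρ w₀ ≤ risk ρ w) {σ t₁ R : ℝ} (hσ : 0 < σ) (ht₁ : 0 ≤ t₁) (hR : 0 ≤ R)
    {w : ℕ → E d} {D : ℕ → ℝ} (hD : ∀ t, 0 ≤ D t) (hD1 : D 1 ≤ R) {T : ℕ}
    (hb : ∀ t, 1 ≤ t → t ≤ T → ((t : ℝ) + t₁ + 1 + 1) * (t + t₁ + 1) * D (t + 1)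
      + 1 / (2 * σ) * ∑ k ∈ Finset.Ico 1 (t + 1), ((k : ℝ) + t₁ + 1) * (risk ρ (w k) - risk ρ w₀)
      ≤ R * (t + t₁ + 1)) (t : ℕ) (ht : 1 ≤ t) (htT : t ≤ T) :
    D t ≤ (1 + 4 * σ) * R / t ∧ risk ρ (wAvg t₁ w t) - risk ρ w₀ ≤ (1 + 4 * σ) * R / t := by
  have ht0 : (0 : ℝ) < t := by exact_mod_cast ht
  have hR4 : 0 ≤ 4 * σ * R := by positivity
  have hY (n : ℕ) : 0 ≤ ∑ k ∈ Finset.Ico 1 (n + 1),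
      ((k : ℝ) + t₁ + 1) * (risk ρ (w k) - risk ρ w₀) :=
    Finset.sum_nonneg fun k _ => mul_nonneg (by positivity) (sub_nonneg.2 (hmin _))
  constructor
  · rw [le_div_iff₀ ht0]
    suffices D t * t ≤ R by linarith
    -- The weighted bound at `n` concerns the iterate `n + 1`, so the first iterate is covered by
    -- `hD1`.
    obtain ⟨n, rfl⟩ : ∃ n, t = n + 1 := ⟨t - 1, by omega⟩
    rcases Nat.eq_zero_or_pos n with rfl | hn
    · simpa using hD1
    have h1 := hb n hn (by omega)
    have h2 : 0 ≤ 1 / (2 * σ) * ∑ k ∈ Finset.Ico 1 (n + 1),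
      ((k : ℝ) + t₁ + 1) * (risk ρ (w k) - risk ρ w₀) := mul_nonneg (by positivity) (hY n)
    have ha : (0 : ℝ) < n + t₁ + 1 := by positivity
    have h3 : ((n : ℝ) + t₁ + 1 + 1) * D (n + 1) ≤ R := by
      refine le_of_mul_le_mul_right ?_ ha
      linarith
    have h4 : ((n : ℝ) + 1) * D (n + 1) ≤ (n + t₁ + 1 + 1) * D (n + 1) :=
      mul_le_mul_of_nonneg_right (by linarith) (hD _)
    push_cast
    linarith
  · have h1 := hb t ht htT
    have ha : (0 : ℝ) < t + t₁ + 1 := by positivity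
    have h2 : 0 ≤ ((t : ℝ) + t₁ + 1 + 1) * (t + t₁ + 1) * D (t + 1) :=
      mul_nonneg (by positivity) (hD _)
    have h3 := risk_wAvg_sub_le h (m := risk ρ w₀) ht₁ w t ht
    have h4 := mul_le_mul_of_nonneg_right (half_mul_le_sum_weights ht₁ t)
      (sub_nonneg.2 (hmin (wAvg t₁ w t)))
    set Y := ∑ k ∈ Finset.Ico 1 (t + 1), ((k : ℝ) + t₁ + 1) * (risk ρ (w k) - risk ρ w₀)
    set x := risk ρ (wAvg t₁ w t) - risk ρ w₀
    have h5 : Y ≤ 2 * σ * (R * (t + t₁ + 1)) := by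
      have h6 : 1 / (2 * σ) * Y ≤ R * (t + t₁ + 1) := by linarith
      rwa [one_div_mul_eq_div, div_le_iff₀' (by positivity)] at h6
    rw [le_div_iff₀ ht0]
    have h7 : x * t ≤ 4 * σ * R := by
      refine le_of_mul_le_mul_right ?_ ha
      linarith
    linarith

theorem one_le_log_div {T : ℕ} {δ : ℝ} (hT : 2 < T) (hδ : 0 < δ) (hδ1 : δ < 1) :
    1 ≤ Real.log (T / δ) := by
  have hT3 : (3 : ℝ) ≤ T := by exact_mod_cast hT
  rw [Real.le_log_iff_exp_le (by positivity), le_div_iff₀ hδ]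
  have := Real.exp_one_lt_d9
  nlinarith [Real.exp_pos 1]

end SPAUC

end

theorem mainTheorem6 (d : ℕ) (X : Set (SPAUC.E d)) (hX : Bornology.IsBounded X)
    (ρ : Measure (SPAUC.Example d)) [IsProbabilityMeasure ρ]
    (hsupp : ∀ᵐ z ∂ρ, z.1 ∈ X ∧ (z.2 = 1 ∨ z.2 = -1))
    (hp : 0 < SPAUC.posProb ρ ∧ SPAUC.posProb ρ < 1)
    (φ : SPAUC.E d → ℝ) (hφ : φ = SPAUC.phi ρ (fun _ => 0)) :
    -- every point has exactly one projection onto the set of minimizers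
    (∀ w, ∃! v, SPAUC.IsProj (SPAUC.solSet φ) w v) ∧
    -- quadratic functional growth holds for some parameter
    (∃ σ, SPAUC.QuadraticGrowth φ σ) ∧
    -- and for every such parameter the fast rates hold
    ∀ σ, SPAUC.QuadraticGrowth φ σ →
      ∃ (C : ℝ) (m : ℕ), ∀ (T : ℕ) (δ t₁ : ℝ), 2 < T → 0 < δ → δ < 1 →
        32 * (16 * SPAUC.kappa X ^ 2) * σ⁻¹ * Real.log (2 * T / δ) ≤ t₁ →
        ∀ (S : Type*) [MeasurableSpace S] (μ : Measure S) [IsProbabilityMeasure μ]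
          (z : ℕ → S → SPAUC.Example d) (w : ℕ → S → SPAUC.E d),
          (∀ i, Measurable (z i)) → ProbabilityTheory.iIndepFun z μ → (∀ i, μ.map (z i) = ρ) →
          (∀ s, SPAUC.IsSPAUC (fun _ => 0) (SPAUC.stepSize σ σ t₁)
            (fun i => z i s) (fun t => w t s)) →
          ENNReal.ofReal (1 - δ) ≤ μ {s | ∀ t : ℕ, 1 ≤ t → t ≤ T →
            (∃ v, SPAUC.IsProj (SPAUC.solSet φ) (w t s) v ∧
              ‖w t s - v‖ ^ 2 ≤ C * (1 + t₁) * Real.log (T / δ) ^ m / t) ∧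
            φ (SPAUC.wAvg t₁ (fun k => w k s) t) - (⨅ u, φ u)
              ≤ C * (1 + t₁) * Real.log (T / δ) ^ m / t} := by
  obtain rfl : φ = SPAUC.risk ρ := hφ.trans (SPAUC.phi_zero ρ)
  have h := SPAUC.goodLaw_kappa hX hsupp hp
  have hA := SPAUC.hess_isSymmetric h
  have hA0 := SPAUC.inner_hess_nonneg h
  obtain ⟨w₀, hf⟩ := SPAUC.exists_risk_center h
  refine ⟨fun w => ⟨SPAUC.projKer (SPAUC.hess h) w₀ w,
    (SPAUC.isProj_iff_eq_projKer hA hA0 hf).2 rfl,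
    fun v hv => (SPAUC.isProj_iff_eq_projKer hA hA0 hf).1 hv⟩,
    SPAUC.exists_quadraticGrowth hA hA0 hf, fun σ hσ => ?_⟩
  have hσ0 := hσ.1
  have hmin (w : SPAUC.E d) : SPAUC.risk ρ w₀ ≤ SPAUC.risk ρ w := by
    rw [hf w]; exact le_add_of_nonneg_right (hA0 _)
  have hinf : ⨅ u, SPAUC.risk ρ u = SPAUC.risk ρ w₀ :=
    le_antisymm (ciInf_le ⟨_, Set.forall_mem_range.2 hmin⟩ w₀) (le_ciInf hmin)
  set K : ℝ := (d + 1) * (2 * SPAUC.kappa X ^ 2 + SPAUC.logFactor d)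
  set R := SPAUC.rateConst h w₀ σ K (SPAUC.logFactor d) with hR
  have hℓ := SPAUC.logFactor_nonneg d
  have hN : 0 < SPAUC.sizeConst σ := by unfold SPAUC.sizeConst; positivity
  have hRD : ‖SPAUC.projKer (SPAUC.hess h) w₀ 0‖ ^ 2 ≤ R := by
    rw [hR, SPAUC.rateConst, two_mul, add_assoc]
    refine le_add_of_nonneg_right ?_
    unfold SPAUC.varConst
    positivity
  have hR0 : 0 ≤ R := (sq_nonneg _).trans hRD
  -- The distance needs `R` and the averaged risk `4 * σ * R`; the sum serves both. The exponent is
  -- the power of `Λ` in `pathwise_bound`.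
  refine ⟨(1 + 4 * σ) * R, 4, fun T δ t₁ hT hδ hδ1 ht₁ S _ μ _ z w hz hind hlaw hw => ?_⟩
  have hΛ1 := SPAUC.one_le_log_div hT hδ hδ1
  have hT0 : (0 : ℝ) < T := by exact_mod_cast (by omega : 0 < T)
  set Λ := Real.log (T / δ) with hΛ
  have hTΛ : Real.log T ≤ Λ :=
    Real.log_le_log hT0 ((le_div_iff₀ hδ).2 (mul_le_of_le_one_right hT0.le hδ1.le))
  -- The lower bound on `t₁` enters only here; it yields `512` where `48` is enough to keep the
  -- iterates small.
  have hκt : 48 * SPAUC.kappa X ^ 2 ≤ σ * t₁ := by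
    have h1 : 1 ≤ Real.log (2 * T / δ) := by
      refine hΛ1.trans (Real.log_le_log (by positivity) ?_)
      gcongr
      linarith
    have h2 := mul_le_mul_of_nonneg_left ht₁ hσ0.le
    have h3 : σ * (32 * (16 * SPAUC.kappa X ^ 2) * σ⁻¹ * Real.log (2 * T / δ))
        = 512 * SPAUC.kappa X ^ 2 * Real.log (2 * T / δ) := by
      field_simp
      ring
    rw [h3] at h2
    nlinarith [sq_nonneg (SPAUC.kappa X)]
  have ht0 : 0 ≤ t₁ :=
    nonneg_of_mul_nonneg_right ((by positivity : 0 ≤ 48 * SPAUC.kappa X ^ 2).trans hκt) hσ0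
  refine (SPAUC.measure_good_ge h w₀ hσ0 ht0 (by omega) hδ hΛ hΛ1 hz hind hlaw
    (SPAUC.stepSize σ σ t₁)).trans (measure_mono ?_)
  rintro s ⟨hs1, hs2, hs3⟩ t ht htT
  -- The value `w 0 s` is unconstrained, so the bounds are proved for `spaucSeq` and transferred at
  -- indices `k ≥ 1`, the only ones in the average.
  have hws : ∀ k, 1 ≤ k → w k s = SPAUC.spaucSeq (SPAUC.stepSize σ σ t₁) (fun i => z i s) k :=
    (hw s).eq_spaucSeq
  have hpath := SPAUC.pathwise_bound h hf hσ hℓ hΛ1 ht0 hκt hTΛ hs1 hs2 (fun _ => rfl) hs3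
  rw [← hR] at hpath
  have hfin := SPAUC.rates_of_weighted_bound h hmin hσ0 ht0
    (R := R * Λ ^ 4 * (1 + t₁)) (D := fun k => ‖SPAUC.spaucSeq (SPAUC.stepSize σ σ t₁)
      (fun i => z i s) k - SPAUC.projKer (SPAUC.hess h) w₀ (SPAUC.spaucSeq
      (SPAUC.stepSize σ σ t₁) (fun i => z i s) k)‖ ^ 2) (by positivity) (fun _ => sq_nonneg _)
    (by
      rw [SPAUC.spaucSeq_one, zero_sub, norm_neg, mul_assoc]
      refine hRD.trans (le_mul_of_one_le_right hR0 ?_)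
      exact one_le_mul_of_one_le_of_one_le (one_le_pow₀ hΛ1) (by linarith)) hpath t ht htT
  have e : (1 + 4 * σ) * R * (1 + t₁) * Λ ^ 4 / t = (1 + 4 * σ) * (R * Λ ^ 4 * (1 + t₁)) / t := by
    ring
  rw [e, hinf]
  refine ⟨⟨_, (SPAUC.isProj_iff_eq_projKer hA hA0 hf).2 rfl, ?_⟩, ?_⟩
  · rw [hws t ht]
    exact hfin.1
  · have e2 : SPAUC.wAvg t₁ (fun k => w k s) t
        = SPAUC.wAvg t₁ (SPAUC.spaucSeq (SPAUC.stepSize σ σ t₁) fun i => z i s) t := by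
      unfold SPAUC.wAvg
      congr 1
      exact Finset.sum_congr rfl fun k hk => congrArg _ (hws k (Finset.mem_Icc.1 hk).1)
    rw [e2]
    exact hfin.2
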